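/- Let $G$ be a balanced $X,Y$-bipartite graph on $2n$ vertices: $V(G)$ is partitioned into two independent sets $X,Y$ with $|X|=|Y|=n$. A 2-coloring of the edges of $G$ is a pair $(E_R,E_B)$ of sets of (red and blue) edges with $E(G)=E_R\cup E_B$; an edge is allowed to have both colors. For $X'\subseteq X$ and $Y'\subseteq Y$ let $e_R(X',Y')$ and $e_B(X',Y')$ be the numbers of red and of blue edges between $X'$ and $Y'$. For $\eta\ge 0$, the coloring is called $\eta$-extremal if there are a set $X'\subseteq X$ and a partition $\{Y_1,Y_2\}$ of $Y$ such that $|X'|,|Y_1|,|Y_2|\ge(1/2-\eta)n$, $e_R(X',Y_1)\le\eta n^2$ and $e_B(X',Y_2)\le\eta n^2$. Proposition. Let $\eta\ge 0$ and $\gamma$ be real numbers with $0\le 16\sqrt{\eta}<\gamma\le\frac14$, and let $n$ be an integer with $n\ge 3/\gamma$. Let $G$ be a balanced $X,Y$-bipartite graph on $2n$ vertices with minimum degree $\delta(G)\ge(3/4+\gamma)n$, and let a 2-coloring of the edges of $G$ be given that is $\eta$-extremal. Then $G$ has a monochromatic path with at least $2\lceil n/2\rceil$ vertices and a monochromatic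 cycle of length at least $2\lfloor n/2\rfloor$ (the two may have different colors). -/

import Mathlib

/-- `G` is a balanced `X,Y`-bipartite graph on `2n` vertices: `X` and `Y` are independent sets
which partition the vertex set, and each of them has `n` elements. -/
structure IsBalancedBipartite {V : Type*} (G : SimpleGraph V) (X Y : Finset V) (n : ℕ) :
    Prop where
  bipartite : G.IsBipartiteWith (X : Set V) (Y : Set V)
  cover : ∀ v : V, v ∈ X ∨ v ∈ Y
  card_left : X.card = n
  card_right : Y.card = n

/-- A 2-coloring of the edges of `G`, given by the spanning subgraphs `R` of red edges and `B` of
blue edges: every edge of `G` is red or blue (an edge is allowed to be both). -/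
def IsTwoColoring {V : Type*} (G R B : SimpleGraph V) : Prop :=
  R ⊔ B = G

open Classical in
/-- The number of edges of `H` between two disjoint vertex sets `S` and `T`. -/
noncomputable def edgesBetween {V : Type*} (H : SimpleGraph V) (S T : Finset V) : ℕ :=
  (H.interedges S T).card

/-- The 2-coloring with red graph `R` and blue graph `B` of a balanced `X,Y`-bipartite graph on
`2n` vertices is `η`-extremal. -/
def IsExtremalColoring {V : Type*} (R B : SimpleGraph V) (X Y : Finset V) (n : ℕ) (η : ℝ) :
    Prop :=
  ∃ X' Y₁ Y₂ : Finset V,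
    X' ⊆ X ∧ Disjoint Y₁ Y₂ ∧ (∀ v, v ∈ Y ↔ v ∈ Y₁ ∨ v ∈ Y₂) ∧
    (1 / 2 - η) * n ≤ X'.card ∧ (1 / 2 - η) * n ≤ Y₁.card ∧ (1 / 2 - η) * n ≤ Y₂.card ∧
    (edgesBetween R X' Y₁ : ℝ) ≤ η * (n : ℝ) ^ 2 ∧
    (edgesBetween B X' Y₂ : ℝ) ≤ η * (n : ℝ) ^ 2

/-- `H` contains a path of order (number of vertices) at least `m`. -/
def HasPathOfOrderAtLeast {V : Type*} (H : SimpleGraph V) (m : ℕ) : Prop :=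
  ∃ (u v : V) (p : H.Walk u v), p.IsPath ∧ m ≤ p.support.length

/-- `H` contains a cycle of length (number of edges) at least `m`. -/
def HasCycleOfLengthAtLeast {V : Type*} (H : SimpleGraph V) (m : ℕ) : Prop :=
  ∃ (u : V) (p : H.Walk u u), p.IsCycle ∧ m ≤ p.length

/-! Write c = γn and g = γ²n/256, so that ηn ≤ g and gn = c²/256. A vertex misses at most n/4 − c
vertices of the other class. Hence between two sets of about n/2 vertices with few red edges, most
blue degrees exceed n/4, and Chvátal's bipartite degree condition gives a Hamiltonian cycle in blue.
It tolerates a few poor vertices, provided that each of them has more blue neighbours than there are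
poor vertices (`exists_cycleList_of_levels`, `exists_cycleList_of_typical`).

The pair (X', Y₁) is almost blue and (X', Y₂) almost red. Up to exchanging colors, at least half of
Y has many blue neighbours in X'. If at least half of X has many blue neighbours in Y₁, then (X',
Y₁) can be adjusted to sides of size ⌈n/2⌉ that carry a blue Hamiltonian cycle
(`exists_cycleList_of_few_edges`). Otherwise the remaining vertices of X form a set Z of more than
n/2 vertices, and (Z, Y₁) is almost red. If at least half of Y has many red neighbours in Z, a red
cycle arises around (Z, Y₁) in the same way (`exists_cycleList_of_small_degree`).

Otherwise a set U of more than n/2 vertices of Y has few red neighbours in Z. Up to few vertices U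
lies in Y₂, and there are two disjoint red blocks, inside (X', Y₂) and (Z, Y₁), besides the blue
pair (Z, U). A vertex of Z with many red neighbours in U connects the red blocks. Two connectors
give a long red cycle; none gives a blue cycle on 2⌈n/2⌉ vertices; exactly one gives a long red path
and, once it is deleted, a blue cycle of length 2⌊n/2⌋ (`exists_of_four_blocks`). Only this last
case can need different colors. -/

/-! ### Cycles and paths as lists of vertices. -/

section CycleList

variable {V : Type*}

/-- The list `l` enumerates, without repetition and in cyclic order, the vertices of a closed
walk in `H`. -/
def IsCycleList (H : SimpleGraph V) (l : List V) : Prop :=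
  l.Nodup ∧ l.IsChain H.Adj ∧ ∀ a ∈ l.getLast?, ∀ b ∈ l.head?, H.Adj a b

theorem IsCycleList.mono {H K : SimpleGraph V} (h : H ≤ K) {l : List V} (hl : IsCycleList H l) :
    IsCycleList K l :=
  ⟨hl.1, hl.2.1.imp fun _ _ hab => h hab, fun a ha b hb => h (hl.2.2 a ha b hb)⟩

theorem IsCycleList.rotate {H : SimpleGraph V} {l₁ l₂ : List V}
    (h : IsCycleList H (l₁ ++ l₂)) : IsCycleList H (l₂ ++ l₁) := by
  rcases eq_or_ne l₁ [] with rfl | h₁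
  · simpa using h
  rcases eq_or_ne l₂ [] with rfl | h₂
  · simpa using h
  obtain ⟨hn, hc, hcl⟩ := h
  rw [List.isChain_append] at hc
  refine ⟨(List.perm_append_comm.nodup_iff).1 hn, ?_, ?_⟩
  · rw [List.isChain_append]
    refine ⟨hc.2.1, hc.1, fun a ha b hb => hcl a ?_ b ?_⟩
    · rwa [List.getLast?_append_of_ne_nil _ h₂]
    · rwa [List.head?_append_of_ne_nil _ h₁]
  · intro a ha b hb
    rw [List.getLast?_append_of_ne_nil _ h₁] at ha
    rw [List.head?_append_of_ne_nil _ h₂] at hb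
    exact hc.2.2 a ha b hb

theorem hasPathOfOrderAtLeast_of_isChain {H : SimpleGraph V} {l : List V} (hn : l.Nodup)
    (hc : l.IsChain H.Adj) (hl : l ≠ []) {m : ℕ} (hm : m ≤ l.length) :
    HasPathOfOrderAtLeast H m := by
  refine ⟨_, _, SimpleGraph.Walk.ofSupport l hl hc, ?_, ?_⟩
  · rw [SimpleGraph.Walk.isPath_def, SimpleGraph.Walk.support_ofSupport]
    exact hn
  · rwa [SimpleGraph.Walk.support_ofSupport]

theorem IsCycleList.hasCycle {H : SimpleGraph V} {l : List V} (h : IsCycleList H l)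
    (hl : 3 ≤ l.length) {m : ℕ} (hm : m ≤ l.length) : HasCycleOfLengthAtLeast H m := by
  obtain ⟨hn, hc, hcl⟩ := h
  have hne : l ≠ [] := by rintro rfl; simp at hl
  have hadj : H.Adj (l.getLast hne) (l.head hne) :=
    hcl _ (List.getLast_mem_getLast? hne) _ (List.head_mem_head? hne)
  set p := SimpleGraph.Walk.ofSupport l hne hc with hp
  have hpp : p.IsPath := by
    rw [SimpleGraph.Walk.isPath_def, SimpleGraph.Walk.support_ofSupport]; exact hn
  have hlen : p.length = l.length - 1 := SimpleGraph.Walk.length_ofSupport hne hc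
  refine ⟨_, SimpleGraph.Walk.cons hadj p, ?_, ?_⟩
  · rw [SimpleGraph.Walk.cons_isCycle_iff]
    refine ⟨hpp, fun he => ?_⟩
    have := hpp.length_eq_one_of_mem_edges (by rwa [Sym2.eq_swap] at he)
    omega
  · rw [SimpleGraph.Walk.length_cons, hlen]; omega

/-- A cycle that may use the extra edge `xy` yields a cycle that avoids it or a path from `x` to
`y` on the same vertices. -/
theorem IsCycleList.of_sup_edge {H : SimpleGraph V} {x y : V} (hxy : x ≠ y) {l : List V}
    (h : IsCycleList (H ⊔ SimpleGraph.edge x y) l) (hx : x ∈ l) (hl : 3 ≤ l.length) :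
    ∃ l' : List V, l'.Perm l ∧ l'.IsChain H.Adj ∧
      ((∀ a ∈ l'.getLast?, ∀ b ∈ l'.head?, H.Adj a b) ∨
        l'.head? = some x ∧ l'.getLast? = some y) := by
  obtain ⟨l₁, l₂, rfl⟩ := List.append_of_mem hx
  -- With x in first place, the extra edge can only be the first step or the closing edge.
  have h' := h.rotate
  have hperm : (x :: l₂ ++ l₁).Perm (l₁ ++ x :: l₂) := List.perm_append_comm
  rw [List.cons_append] at h' hperm
  have hlen := hperm.length_eq
  generalize l₂ ++ l₁ = q at h' hperm hlen
  obtain ⟨hn, hc, hcl⟩ := h'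
  rw [List.nodup_cons] at hn
  have hadj : ∀ a b, (H ⊔ SimpleGraph.edge x y).Adj a b → a ≠ x → b ≠ x → H.Adj a b := by
    intro a b hab ha hb
    rw [SimpleGraph.sup_adj, SimpleGraph.edge_adj] at hab
    grind
  have hadjx : ∀ b, (H ⊔ SimpleGraph.edge x y).Adj x b → b ≠ y → H.Adj x b := by
    intro b hab hb
    rw [SimpleGraph.sup_adj, SimpleGraph.edge_adj] at hab
    grind
  have hq : q.IsChain H.Adj := by
    have h1 : q.IsChain (H ⊔ SimpleGraph.edge x y).Adj := hc.of_cons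
    have h2 : q.IsChain fun a b => a ≠ x ∧ b ≠ x :=
      List.Pairwise.isChain (List.pairwise_of_forall_mem_list fun a ha b hb =>
        ⟨fun e => hn.1 (e ▸ ha), fun e => hn.1 (e ▸ hb)⟩)
    rw [List.isChain_iff_getElem] at h1 h2 ⊢
    exact fun i hi => hadj _ _ (h1 i hi) (h2 i hi).1 (h2 i hi).2
  have hqne : q ≠ [] := by rintro rfl; simp at hlen hl; omega
  obtain ⟨a, q', rfl⟩ := List.exists_cons_of_ne_nil hqne
  obtain ⟨b, hb⟩ : ∃ b, (a :: q').getLast? = some b := ⟨_, List.getLast?_eq_getLast_of_ne_nil hqne⟩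
  have hxa := hc.rel
  have hbx : (H ⊔ SimpleGraph.edge x y).Adj b x := hcl b (by simpa using hb) x (by simp)
  by_cases hay : a = y
  · refine ⟨x :: (a :: q').reverse, ?_, ?_, Or.inr ⟨rfl, by simp [List.getLast?_cons, hay]⟩⟩
    · exact ((List.reverse_perm _).cons x).trans hperm
    -- The two neighbours of x on the cycle differ because the cycle has at least three vertices; so
    -- the edge xy is used only once.
    · have hby : b ≠ y := by
        rintro rfl
        subst hay
        rcases List.eq_nil_or_concat q' with rfl | ⟨r, c, rfl⟩
        · simp at hlen hl; omega
        · rw [List.concat_eq_append, ← List.cons_append,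
            List.getLast?_append_of_ne_nil _ (by simp)] at hb
          obtain rfl : c = a := by simpa using hb
          simp at hn
      refine List.isChain_cons.2 ⟨?_, ?_⟩
      · intro c hc'
        rw [List.head?_reverse, hb] at hc'
        obtain rfl : b = c := by simpa using hc'
        exact hadjx _ hbx.symm hby
      · rw [List.isChain_reverse]
        exact hq.imp fun _ _ h => h.symm
  · have hch : (x :: a :: q').IsChain H.Adj :=
      List.isChain_cons.2 ⟨by simpa using hadjx _ hxa hay, hq⟩
    refine ⟨_, hperm, hch, ?_⟩
    by_cases hby : b = y
    · right; subst hby; simp [List.getLast?_cons_cons, hb]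
    · left
      intro c hc' d hd
      rw [List.getLast?_cons_cons, hb] at hc'
      obtain rfl : b = c := by simpa using hc'
      obtain rfl : x = d := by simpa using hd
      exact (hadjx _ hbx.symm hby).symm

end CycleList

open Classical in
/-- The number of neighbours of `v` in `T`. -/
noncomputable def degIn {V : Type*} (H : SimpleGraph V) (v : V) (T : Finset V) : ℕ :=
  (T.filter (H.Adj v)).card

/-! ### Rotation of Hamiltonian paths, and complete bipartite graphs. -/

section Hamiltonian

open Finset
open scoped Classical

variable {V : Type*}

theorem degIn_mono_graph {H K : SimpleGraph V} (h : H ≤ K) (v : V) (T : Finset V) :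
    degIn H v T ≤ degIn K v T :=
  card_le_card fun _ hw => by
    rw [mem_filter] at hw ⊢
    exact ⟨hw.1, h hw.2⟩

/-- Each consecutive pair (a, b) contributes at most one to the left side, and then its first entry
a satisfies R; distinct pairs are charged to distinct positions. -/
theorem countP_add_countP_dropLast_le {P Q R : V → Prop} (c : V) (q : List V)
    (h : (c :: q).IsChain fun a b => ¬(P b ∧ Q a) ∧ (P b → R a) ∧ (Q a → R a)) :
    q.countP (P ·) + (c :: q).dropLast.countP (Q ·) ≤ (c :: q).countP (R ·) := by
  induction q generalizing c with
  | nil => simp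
  | cons d q ih =>
    rw [List.isChain_cons_cons] at h
    have := ih d h.2
    rw [List.dropLast_cons_cons, List.countP_cons, List.countP_cons (a := c) (l := d :: q),
      List.countP_cons (a := c)]
    obtain ⟨⟨h1, h2, h3⟩, -⟩ := h
    by_cases hP : P d <;> by_cases hQ : Q c <;> by_cases hR : R c <;> simp_all <;> omega

theorem card_filter_le_countP {P : V → Prop} {A : Finset V} {q : List V}
    (h : ∀ a ∈ A, P a → a ∈ q) : (A.filter P).card ≤ q.countP (P ·) := by
  have : A.filter P ⊆ (q.filter (P ·)).toFinset := by
    intro a ha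
    rw [mem_filter] at ha
    simp [ha.2, h a ha.1 ha.2]
  rw [List.countP_eq_length_filter]
  exact (card_le_card this).trans (List.toFinset_card_le _)

theorem countP_le_card {R : V → Prop} {S : Finset V} (hR : ∀ a, R a → a ∈ S) {q : List V}
    (hq : q.Nodup) : q.countP (R ·) ≤ S.card := by
  rw [List.countP_eq_length_filter, ← List.toFinset_card_of_nodup (hq.filter _)]
  exact card_le_card fun a ha => hR a (by simp at ha; exact ha.2)

theorem exists_crossing (p : List V) {r : V → V → Prop} (h : ¬ p.IsChain fun a b => ¬ r a b) :
    ∃ l₁ a b l₂, p = l₁ ++ a :: b :: l₂ ∧ r a b := by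
  rw [List.isChain_iff_forall_rel_of_append_cons_cons] at h
  push Not at h
  obtain ⟨a, b, l₁, l₂, h, hr⟩ := h
  exact ⟨l₁, a, b, l₂, h, hr⟩

/-- The rotation argument of Bondy and Chvátal for bipartite graphs. -/
theorem exists_cycleList_of_path {H : SimpleGraph V} {S T : Finset V} {x y : V}
    (hH : H.IsBipartiteWith (S : Set V) (T : Set V)) (hx : x ∈ S) (hy : y ∈ T)
    {p : List V} (hn : p.Nodup) (hc : p.IsChain H.Adj) (hpx : p.head? = some x)
    (hpy : p.getLast? = some y) (hp : ∀ v, v ∈ S ∨ v ∈ T → v ∈ p)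
    (hd : S.card < degIn H x T + degIn H y S) :
    ∃ l : List V, l.Perm p ∧ IsCycleList H l := by
  obtain ⟨q, rfl⟩ : ∃ q, p = x :: q := by
    cases p with
    | nil => simp at hpx
    | cons a q => exact ⟨q, by simp at hpx; rw [hpx]⟩
  -- Without a consecutive pair a, b such that x ~ b and y ~ a, the predecessors of the neighbours
  -- of x and the neighbours of y would be disjoint subsets of S, against the degree sum.
  have hcross : ¬ (x :: q).IsChain fun a b => ¬(H.Adj x b ∧ H.Adj y a) := by
    intro hno
    have hch : (x :: q).IsChain fun a b =>
        ¬(H.Adj x b ∧ H.Adj y a) ∧ (H.Adj x b → a ∈ S) ∧ (H.Adj y a → a ∈ S) := by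
      rw [List.isChain_iff_getElem] at hno hc ⊢
      intro i hi
      refine ⟨hno i hi, fun h => ?_, fun h => ?_⟩
      · exact hH.symm.mem_of_mem_adj (hH.mem_of_mem_adj hx h) (hc i hi).symm
      · exact hH.symm.mem_of_mem_adj hy h
    have h1 := countP_add_countP_dropLast_le x q hch
    have h2 : degIn H x T ≤ q.countP (H.Adj x ·) := card_filter_le_countP fun a ha hxa => by
      have := hp a (Or.inr ha)
      rw [List.mem_cons] at this
      exact this.resolve_left hxa.ne'
    have h3 : degIn H y S ≤ (x :: q).dropLast.countP (H.Adj y ·) :=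
      card_filter_le_countP fun a ha hya => by
        have := hp a (Or.inl ha)
        rw [← List.dropLast_append_getLast? y hpy] at this
        rw [List.mem_append, List.mem_singleton] at this
        exact this.resolve_right hya.ne'
    have h4 := countP_le_card (R := (· ∈ S)) (fun _ h => h) hn
    omega
  obtain ⟨l₁, a, b, l₂, hl, hxb, hya⟩ := exists_crossing _ hcross
  rw [hl] at hn hc hpx hpy ⊢
  have hsplit : l₁ ++ a :: b :: l₂ = (l₁ ++ [a]) ++ (b :: l₂) := by simp
  rw [hsplit] at hn hc hpx hpy ⊢
  rw [List.isChain_append] at hc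
  rw [List.getLast?_append_of_ne_nil _ (by simp)] at hpy
  rw [List.head?_append_of_ne_nil _ (by simp)] at hpx
  -- The rotated cycle is x … a y … b x, closed by the edges ay and bx.
  have hperm : ((l₁ ++ [a]) ++ (b :: l₂).reverse).Perm ((l₁ ++ [a]) ++ (b :: l₂)) :=
    (List.reverse_perm _).append_left _
  refine ⟨_, hperm, hperm.nodup_iff.2 hn, ?_, ?_⟩
  · rw [List.isChain_append, List.isChain_reverse]
    refine ⟨hc.1, hc.2.1.imp fun _ _ h => h.symm, ?_⟩
    intro c hc' d hd'
    rw [List.head?_reverse, hpy] at hd'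
    obtain rfl : y = d := by simpa using hd'
    obtain rfl : a = c := by simpa using hc'
    exact hya.symm
  · intro c hc' d hd'
    rw [List.head?_append_of_ne_nil _ (by simp), hpx] at hd'
    rw [List.getLast?_append_of_ne_nil _ (by simp), List.getLast?_reverse] at hc'
    obtain rfl : x = d := by simpa using hd'
    obtain rfl : b = c := by simpa using hc'
    exact hxb.symm

theorem exists_alternating_list {r : V → V → Prop} (hr : ∀ a b, r a b → r b a) (x y : V)
    (xs ys : List V)
    (hl : xs.length = ys.length) (h : ∀ a ∈ x :: xs, ∀ b ∈ y :: ys, r a b) :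
    ∃ l : List V, l.Perm (x :: xs ++ y :: ys) ∧ l.IsChain r ∧ l.head? = some x ∧
      ∃ b ∈ y :: ys, l.getLast? = some b := by
  induction xs generalizing x y ys with
  | nil =>
    obtain rfl : ys = [] := by simpa using hl.symm
    exact ⟨[x, y], by simp, by simpa using h, rfl, y, by simp, rfl⟩
  | cons x' xs ih =>
    obtain ⟨y', ys, rfl⟩ : ∃ y' ys', ys = y' :: ys' := by
      cases ys with
      | nil => simp at hl
      | cons y' ys' => exact ⟨_, _, rfl⟩
    obtain ⟨l, hp, hc, hh, b, hb, hlast⟩ := ih x' y' ys (by simpa using hl)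
      fun a ha b hb => h a (List.mem_cons_of_mem _ ha) b (List.mem_cons_of_mem _ hb)
    have hne : l ≠ [] := by rintro rfl; simp at hh
    refine ⟨x :: y :: l, ?_, ?_, rfl, b, List.mem_cons_of_mem _ hb, ?_⟩
    · rw [List.cons_append]
      refine List.Perm.cons _ ?_
      exact (hp.cons y).trans List.perm_middle.symm
    · rw [List.isChain_cons_cons, List.isChain_cons]
      refine ⟨h x (by simp) y (by simp), fun c hc' => ?_, hc⟩
      rw [hh] at hc'
      obtain rfl : x' = c := by simpa using hc'
      exact hr _ _ (h x' (by simp) y (by simp))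
    · obtain ⟨c, l, rfl⟩ := List.exists_cons_of_ne_nil hne
      rw [List.getLast?_cons_cons, List.getLast?_cons_cons, hlast]

theorem exists_cycleList_of_complete {H : SimpleGraph V} {S T : Finset V} (hST : Disjoint S T)
    (hcard : S.card = T.card) (hH : ∀ x ∈ S, ∀ y ∈ T, H.Adj x y) :
    ∃ l : List V, IsCycleList H l ∧ ∀ v, v ∈ l ↔ v ∈ S ∨ v ∈ T := by
  rcases hS : S.toList with - | ⟨x, xs⟩
  · have hS' : S = ∅ := by simpa using hS
    have hT' : T = ∅ := by rw [← card_eq_zero, ← hcard, hS', card_empty]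
    subst hS' hT'
    exact ⟨[], ⟨List.nodup_nil, List.isChain_nil, by simp⟩, by simp⟩
  rcases hT : T.toList with - | ⟨y, ys⟩
  · have h1 := S.length_toList
    have h2 := T.length_toList
    rw [hS] at h1
    rw [hT] at h2
    simp at h1 h2
    omega
  have h1 := S.length_toList
  have h2 := T.length_toList
  have hmS : ∀ v, v ∈ x :: xs ↔ v ∈ S := fun v => by rw [← hS, mem_toList]
  have hmT : ∀ v, v ∈ y :: ys ↔ v ∈ T := fun v => by rw [← hT, mem_toList]
  have hnS := S.nodup_toList
  have hnT := T.nodup_toList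
  rw [hS] at h1 hnS
  rw [hT] at h2 hnT
  simp only [List.length_cons] at h1 h2
  obtain ⟨l, hp, hc, hh, b, hb, hlast⟩ := exists_alternating_list (r := H.Adj)
    (fun _ _ h => h.symm) x y xs ys (by omega)
    fun a ha b hb => hH a ((hmS a).1 ha) b ((hmT b).1 hb)
  refine ⟨l, ⟨hp.nodup_iff.2 ?_, hc, ?_⟩, fun v => ?_⟩
  · exact hnS.append hnT fun v hv hv' => disjoint_left.1 hST ((hmS v).1 hv) ((hmT v).1 hv')
  · intro c hc' d hd
    rw [hh] at hd
    rw [hlast] at hc'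
    obtain rfl : x = d := by simpa using hd
    obtain rfl : b = c := by simpa using hc'
    exact (hH x ((hmS x).1 (by simp)) b ((hmT b).1 hb)).symm
  · rw [hp.mem_iff, List.mem_append, hmS, hmT]

end Hamiltonian

/-! ### Chvátal's condition and its consequences. -/

section Chvatal

open Finset
open scoped Classical

variable {V : Type*}

theorem degIn_congr {H K : SimpleGraph V} {v : V} {A : Finset V}
    (h : ∀ w ∈ A, H.Adj v w ↔ K.Adj v w) : degIn H v A = degIn K v A := by
  unfold degIn
  exact congrArg card (filter_congr h)

theorem degIn_between_left (H : SimpleGraph V) {S T : Finset V} {x : V} (hx : x ∈ S) :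
    degIn (H.between S T) x T = degIn H x T :=
  degIn_congr fun w hw => by rw [SimpleGraph.between_adj]; simp [hx, hw]

theorem degIn_between_right (H : SimpleGraph V) {S T : Finset V} {y : V} (hy : y ∈ T) :
    degIn (H.between S T) y S = degIn H y S :=
  degIn_congr fun w hw => by rw [SimpleGraph.between_adj]; simp [hy, hw]

theorem degIn_mono_set (H : SimpleGraph V) (v : V) {A B : Finset V} (h : A ⊆ B) :
    degIn H v A ≤ degIn H v B :=
  card_le_card (filter_subset_filter _ h)

/-- The number of vertices listed by an enumeration of two disjoint sets. -/
theorem length_eq_of_mem_iff {l : List V} (hl : l.Nodup) {S T : Finset V} (hST : Disjoint S T)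
    (h : ∀ v, v ∈ l ↔ v ∈ S ∨ v ∈ T) : l.length = S.card + T.card := by
  rw [← List.toFinset_card_of_nodup hl, ← card_union_of_disjoint hST]
  congr 1
  ext v
  rw [List.mem_toFinset, h, mem_union]

/-- If `x` and `y` are nonadjacent in a maximal graph without a Hamiltonian cycle, then the degrees
of `x` and `y` satisfy `d x + d y ≤ |S|`. -/
theorem degIn_add_degIn_le_of_maximal {K : SimpleGraph V} {S T : Finset V}
    (hcard : S.card = T.card) (h2 : 2 ≤ S.card)
    (hK : Maximal (fun K : SimpleGraph V => K.IsBipartiteWith (S : Set V) (T : Set V) ∧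
      ¬ ∃ l : List V, IsCycleList K l ∧ ∀ v, v ∈ l ↔ v ∈ S ∨ v ∈ T) K)
    {x y : V} (hx : x ∈ S) (hy : y ∈ T) (hxy : ¬ K.Adj x y) :
    degIn K x T + degIn K y S ≤ S.card := by
  by_contra! hlt
  obtain ⟨⟨hbip, hno⟩, hmax⟩ := hK
  have hne : x ≠ y := by
    rintro rfl
    exact Set.disjoint_left.1 hbip.disjoint hx hy
  have hbip' : (K ⊔ SimpleGraph.edge x y).IsBipartiteWith (S : Set V) (T : Set V) := by
    refine ⟨hbip.disjoint, fun v w hvw => ?_⟩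
    rw [SimpleGraph.sup_adj, SimpleGraph.edge_adj] at hvw
    rcases hvw with hvw | ⟨⟨rfl, rfl⟩ | ⟨rfl, rfl⟩, -⟩
    · exact hbip.mem_of_adj hvw
    · exact Or.inl ⟨hx, hy⟩
    · exact Or.inr ⟨hy, hx⟩
  have hham : ∃ l : List V, IsCycleList (K ⊔ SimpleGraph.edge x y) l ∧
      ∀ v, v ∈ l ↔ v ∈ S ∨ v ∈ T := by
    by_contra hno'
    have := hmax ⟨hbip', hno'⟩ le_sup_left
    refine hxy (this ?_)
    rw [SimpleGraph.sup_adj, SimpleGraph.edge_adj]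
    exact Or.inr ⟨Or.inl ⟨rfl, rfl⟩, hne⟩
  obtain ⟨l, hl, hmem⟩ := hham
  have hlen := length_eq_of_mem_iff hl.1 (by exact_mod_cast hbip.disjoint) hmem
  replace hlen : 3 ≤ l.length := by omega
  obtain ⟨p, hp, hc, h | ⟨hpx, hpy⟩⟩ := hl.of_sup_edge hne ((hmem x).2 (Or.inl hx)) hlen
  · exact hno ⟨p, ⟨hp.nodup_iff.2 hl.1, hc, h⟩, fun v => hp.mem_iff.trans (hmem v)⟩
  · obtain ⟨l', hl', hcyc⟩ := exists_cycleList_of_path hbip hx hy (hp.nodup_iff.2 hl.1) hc hpx hpy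
      (fun v hv => hp.mem_iff.2 ((hmem v).2 hv)) hlt
    exact hno ⟨l', hcyc, fun v => (hl'.trans hp).mem_iff.trans (hmem v)⟩

/-- Chvátal's degree condition for Hamiltonian cycles in balanced bipartite graphs. -/
theorem exists_cycleList_of_chvatal [Finite V] (H : SimpleGraph V) {S T : Finset V}
    (hST : Disjoint S T) (hcard : S.card = T.card) (h2 : 2 ≤ S.card)
    (hS : ∀ x ∈ S, 1 ≤ degIn H x T) (hT : ∀ y ∈ T, 1 ≤ degIn H y S)
    (hk : ∀ k, 1 ≤ k → k < S.card → k ≤ (S.filter fun x => degIn H x T ≤ k).card →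
      (T.filter fun y => degIn H y S ≤ S.card - k).card < S.card - k) :
    ∃ l : List V, IsCycleList H l ∧ ∀ v, v ∈ l ↔ v ∈ S ∨ v ∈ T := by
  by_contra hno
  have hbip : (H.between S T).IsBipartiteWith (S : Set V) (T : Set V) :=
    SimpleGraph.between_isBipartiteWith (by exact_mod_cast hST)
  -- Only edges between S and T are kept, so that the maximal counterexample is bipartite even if
  -- the given graph is not.
  obtain ⟨K, hHK, hK⟩ := Finite.exists_le_maximal
    (p := fun K : SimpleGraph V => K.IsBipartiteWith (S : Set V) (T : Set V) ∧
      ¬ ∃ l : List V, IsCycleList K l ∧ ∀ v, v ∈ l ↔ v ∈ S ∨ v ∈ T) (a := H.between S T)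
    ⟨hbip, fun ⟨l, hl, hl'⟩ => hno ⟨l, hl.mono SimpleGraph.between_le, hl'⟩⟩
  have hdS : ∀ x ∈ S, degIn H x T ≤ degIn K x T := fun x hx =>
    (degIn_between_left H hx).symm.le.trans (degIn_mono_graph hHK _ _)
  have hdT : ∀ y ∈ T, degIn H y S ≤ degIn K y S := fun y hy =>
    (degIn_between_right H hy).symm.le.trans (degIn_mono_graph hHK _ _)
  have hne : ((S ×ˢ T).filter fun e => ¬ K.Adj e.1 e.2).Nonempty := by
    by_contra hemp
    refine hK.1.2 (exists_cycleList_of_complete hST hcard fun x hx y hy => ?_)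
    by_contra hxy
    exact hemp ⟨(x, y), mem_filter.2 ⟨mem_product.2 ⟨hx, hy⟩, hxy⟩⟩
  -- For a nonadjacent pair of maximal degree sum, every nonneighbour of y in S has degree at most
  -- d(x), and every nonneighbour of x in T has degree at most d(y) ≤ |S| − d(x). Counting these
  -- nonneighbours violates the condition at k = d(x).
  obtain ⟨⟨x, y⟩, he, hmax⟩ := exists_max_image _
    (fun e : V × V => degIn K e.1 T + degIn K e.2 S) hne
  simp only [mem_filter, mem_product] at he hmax
  obtain ⟨⟨hx, hy⟩, hxy⟩ := he
  have hsum := degIn_add_degIn_le_of_maximal hcard h2 hK hx hy hxy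
  have hcompl : ∀ (v : V) (A : Finset V),
      (A.filter fun w => ¬ K.Adj v w).card + degIn K v A = A.card := fun v A => by
    rw [add_comm]; exact card_filter_add_card_filter_not _
  have hcS := hcompl y S
  have hcT := hcompl x T
  have h1 : (S.filter fun w => ¬ K.Adj y w) ⊆ S.filter fun v => degIn H v T ≤ degIn K x T := by
    intro w hw
    rw [mem_filter] at hw ⊢
    refine ⟨hw.1, (hdS w hw.1).trans ?_⟩
    have := hmax (w, y) ⟨⟨hw.1, hy⟩, fun h => hw.2 h.symm⟩
    simpa using this
  have h1' := card_le_card h1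
  have h3 : (T.filter fun w => ¬ K.Adj x w) ⊆
      T.filter fun v => degIn H v S ≤ S.card - degIn K x T := by
    intro w hw
    rw [mem_filter] at hw ⊢
    refine ⟨hw.1, (hdT w hw.1).trans ?_⟩
    have := hmax (x, w) ⟨⟨hx, hw.1⟩, hw.2⟩
    simp only at this
    omega
  have h3' := card_le_card h3
  have hx1 := (hS x hx).trans (hdS x hx)
  have hy1 := (hT y hy).trans (hdT y hy)
  have := hk (degIn K x T) hx1 (by omega) (by omega)
  omega

/-- A degree condition with two levels of exceptional vertices. -/
theorem exists_cycleList_of_levels [Finite V] (H : SimpleGraph V) {S T : Finset V}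
    (hST : Disjoint S T) {m : ℕ} (hSm : S.card = m) (hTm : T.card = m) (hm : 2 ≤ m) {a h : ℝ}
    (ha : 0 ≤ a)
    (hS : ∀ x ∈ S, a < degIn H x T)
    (hS1 : ((S.filter fun x => (degIn H x T : ℝ) ≤ h).card : ℝ) ≤ a)
    (hS2 : ((S.filter fun x => 2 * degIn H x T ≤ m).card : ℝ) ≤ h)
    (hT : ∀ y ∈ T, a < degIn H y S)
    (hT1 : ((T.filter fun y => (degIn H y S : ℝ) ≤ h).card : ℝ) ≤ a)
    (hT2 : ((T.filter fun y => 2 * degIn H y S ≤ m).card : ℝ) ≤ h) :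
    ∃ l : List V, IsCycleList H l ∧ ∀ v, v ∈ l ↔ v ∈ S ∨ v ∈ T := by
  -- Were there k vertices of degree at most k ≤ m/2, the second level would give k ≤ h, then the
  -- first k ≤ a, while all degrees exceed a.
  have key : ∀ {A B : Finset V} (_ : ∀ x ∈ A, a < degIn H x B)
      (_ : ((A.filter fun x => (degIn H x B : ℝ) ≤ h).card : ℝ) ≤ a)
      (_ : ((A.filter fun x => 2 * degIn H x B ≤ m).card : ℝ) ≤ h) (k : ℕ) (_ : 1 ≤ k)
      (_ : 2 * k ≤ m), (A.filter fun x => degIn H x B ≤ k).card < k := by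
    intro A B h0 h1 h2 k hk hkm
    by_contra! hge
    obtain ⟨x, hx⟩ : (A.filter fun x => degIn H x B ≤ k).Nonempty := card_pos.1 (by omega)
    rw [mem_filter] at hx
    have hak : a < k := (h0 x hx.1).trans_le (by exact_mod_cast hx.2)
    have hs2 := card_le_card (show (A.filter fun x => degIn H x B ≤ k) ⊆
      A.filter fun x => 2 * degIn H x B ≤ m from fun v hv => by
        rw [mem_filter] at hv ⊢
        exact ⟨hv.1, by omega⟩)
    have hkh : (k : ℝ) ≤ h := le_trans (by exact_mod_cast hge.trans hs2) h2
    have hs1 := card_le_card (show (A.filter fun x => degIn H x B ≤ k) ⊆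
      A.filter fun x => (degIn H x B : ℝ) ≤ h from fun v hv => by
        rw [mem_filter] at hv ⊢
        exact ⟨hv.1, le_trans (by exact_mod_cast hv.2) hkh⟩)
    have : (k : ℝ) ≤ a := le_trans (by exact_mod_cast hge.trans hs1) h1
    linarith
  have hpos : ∀ {d : ℕ}, a < d → 1 ≤ d := fun {d} hd => by
    have : (0 : ℝ) < d := lt_of_le_of_lt ha hd
    exact_mod_cast this
  refine exists_cycleList_of_chvatal H hST (hSm.trans hTm.symm) (by omega)
    (fun x hx => hpos (hS x hx)) (fun y hy => hpos (hT y hy)) fun k hk hkm hkS => ?_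
  rw [hSm] at hkm ⊢
  -- For k ≤ m/2 the premise on S fails; for larger k the bound on T holds, since m − k ≤ m/2.
  rcases le_or_gt (2 * k) m with hle | hlt
  · exact absurd (key hS hS1 hS2 k hk hle) (by omega)
  · exact key hT hT1 hT2 (m - k) (by omega) (by omega)

/-- A bipartite graph with large minimum degree has a Hamiltonian path between any two vertices
of its larger class. -/
theorem exists_path_list [Finite V] (H : SimpleGraph V) {S T : Finset V}
    (hST : Disjoint S T) (hcard : T.card = S.card + 1)
    (hS : ∀ x ∈ S, T.card < 2 * degIn H x T) (hT : ∀ y ∈ T, T.card < 2 * degIn H y S)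
    {z : V} (hzS : z ∉ S) (hzT : z ∉ T) {y₁ y₂ : V} (hy₁ : y₁ ∈ T) (hy₂ : y₂ ∈ T) (hy : y₁ ≠ y₂) :
    ∃ p : List V, p.Nodup ∧ p.IsChain H.Adj ∧ p.head? = some y₁ ∧ p.getLast? = some y₂ ∧
      p.length = 2 * S.card + 1 ∧ ∀ v ∈ p, v ∈ S ∨ v ∈ T := by
  -- The auxiliary vertex z joins the smaller class with y₁ and y₂ as its only neighbours. A
  -- Hamiltonian cycle passes y₁ z y₂, and deleting z leaves the path.
  obtain ⟨H', hH'⟩ : ∃ H' : SimpleGraph V,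
    H' = H.between S T ⊔ SimpleGraph.edge z y₁ ⊔ SimpleGraph.edge z y₂ := ⟨_, rfl⟩
  have hle : H.between S T ≤ H' := hH' ▸ le_sup_of_le_left le_sup_left
  have hzy₁ : z ≠ y₁ := fun h => hzT (h ▸ hy₁)
  have hzy₂ : z ≠ y₂ := fun h => hzT (h ▸ hy₂)
  have hadj : ∀ v w, H'.Adj v w → v ≠ z → w ≠ z → H.Adj v w := by
    intro v w hvw hv hw
    simp only [hH', SimpleGraph.sup_adj, SimpleGraph.edge_adj, SimpleGraph.between_adj] at hvw
    grind
  have hadjz : ∀ v, H'.Adj z v ↔ v = y₁ ∨ v = y₂ := by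
    intro v
    simp only [hH', SimpleGraph.sup_adj, SimpleGraph.edge_adj, SimpleGraph.between_adj]
    have : z ∉ (S : Set V) := by exact_mod_cast hzS
    have : z ∉ (T : Set V) := by exact_mod_cast hzT
    grind
  have hT2 : 2 ≤ T.card := by
    rw [← card_pair hy]
    exact card_le_card (by intro v hv; simp at hv; rcases hv with rfl | rfl <;> assumption)
  have hdz : 2 ≤ degIn H' z T := by
    rw [← card_pair hy]
    refine card_le_card fun v hv => ?_
    rw [mem_insert, mem_singleton] at hv
    rw [mem_filter, hadjz]
    exact ⟨by rcases hv with rfl | rfl <;> assumption, hv⟩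
  have hdS : ∀ x ∈ S, T.card < 2 * degIn H' x T := fun x hx => (hS x hx).trans_le
    (Nat.mul_le_mul_left 2 ((degIn_between_left H hx).symm.le.trans (degIn_mono_graph hle _ _)))
  have hdT : ∀ y ∈ T, T.card < 2 * degIn H' y (insert z S) := fun y hy => (hT y hy).trans_le
    (Nat.mul_le_mul_left 2 ((degIn_between_right H hy).symm.le.trans
      ((degIn_mono_graph hle _ _).trans (degIn_mono_set _ _ (subset_insert _ _)))))
  have hST' : Disjoint (insert z S) T := disjoint_insert_left.2 ⟨hzT, hST⟩
  have hcS' : (insert z S).card = T.card := by rw [card_insert_of_notMem hzS, hcard]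
  obtain ⟨l, hl, hmem⟩ : ∃ l : List V, IsCycleList H' l ∧
      ∀ v, v ∈ l ↔ v ∈ insert z S ∨ v ∈ T := by
    -- Only z can have degree at most half of the class size, and its degree 2 still exceeds 1.
    refine exists_cycleList_of_levels H' hST' hcS' rfl hT2 (a := 1) (h := 1)
      zero_le_one ?_ ?_ ?_ ?_ ?_ ?_
    · intro x hx
      rcases mem_insert.1 hx with rfl | hx
      · exact_mod_cast hdz
      · have := hdS x hx
        exact_mod_cast (by omega : 1 < degIn H' x T)
    · rw [filter_eq_empty_iff.2]
      · simp
      · intro x hx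
        rcases mem_insert.1 hx with rfl | hx
        · exact not_le.2 (by exact_mod_cast hdz)
        · have := hdS x hx
          exact not_le.2 (by exact_mod_cast (by omega : 1 < degIn H' x T))
    · have : ((insert z S).filter fun x => 2 * degIn H' x T ≤ T.card) ⊆ {z} := by
        intro x hx
        rw [mem_filter, mem_insert] at hx
        rw [mem_singleton]
        by_contra hxz
        have := hdS x (hx.1.resolve_left hxz)
        omega
      exact_mod_cast card_le_card this
    · intro y hy
      have := hdT y hy
      exact_mod_cast (by omega : 1 < degIn H' y (insert z S))
    · rw [filter_eq_empty_iff.2]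
      · simp
      · intro y hy
        have := hdT y hy
        exact not_le.2 (by exact_mod_cast (by omega : 1 < degIn H' y (insert z S)))
    · rw [filter_eq_empty_iff.2]
      · simp
      · intro y hy
        have := hdT y hy
        omega
  have hlen := length_eq_of_mem_iff hl.1 hST' hmem
  obtain ⟨l₁, l₂, rfl⟩ := List.append_of_mem ((hmem z).2 (Or.inl (mem_insert_self _ _)))
  have hl' := hl.rotate
  have hperm : (z :: l₂ ++ l₁).Perm (l₁ ++ z :: l₂) := List.perm_append_comm
  rw [← hperm.length_eq] at hlen
  replace hmem := fun v => hperm.mem_iff.trans (hmem v)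
  rw [List.cons_append] at hl' hmem hlen
  generalize l₂ ++ l₁ = q at hl' hmem hlen
  obtain ⟨hn, hc, hcl⟩ := hl'
  rw [List.nodup_cons] at hn
  rw [List.length_cons] at hlen
  obtain ⟨a, q, rfl⟩ := List.exists_cons_of_ne_nil
    (show q ≠ [] by rintro rfl; rw [List.length_nil] at hlen; omega)
  rcases List.eq_nil_or_concat q with rfl | ⟨r, b, rfl⟩
  · simp only [List.length_cons, List.length_nil] at hlen; omega
  rw [List.concat_eq_append] at *
  have hq : (a :: (r ++ [b])).IsChain H.Adj := by
    have h1 := hc.of_cons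
    rw [List.isChain_iff_getElem] at h1 ⊢
    exact fun i hi => hadj _ _ (h1 i hi) (fun h => hn.1 (h ▸ List.getElem_mem _))
      (fun h => hn.1 (h ▸ List.getElem_mem _))
  have hza := (hadjz a).1 hc.rel
  have hzb := (hadjz b).1 (hcl b (by
    rw [← List.cons_append, ← List.cons_append, List.getLast?_append_of_ne_nil _ (by simp)]
    rfl) z
    (by simp)).symm
  have hab : a ≠ b := by
    rintro rfl
    simp at hn
  have hmem' : ∀ v ∈ a :: (r ++ [b]), v ∈ S ∨ v ∈ T := fun v hv => by
    have h1 := (hmem v).1 (List.mem_cons_of_mem _ hv)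
    rw [mem_insert] at h1
    have h2 : v ≠ z := fun h => hn.1 (h ▸ hv)
    tauto
  have hlast : (a :: (r ++ [b])).getLast? = some b := by
    rw [← List.cons_append, List.getLast?_append_of_ne_nil _ (by simp)]
    rfl
  have hlen' : (a :: (r ++ [b])).length = 2 * S.card + 1 := by
    omega
  rcases hza with rfl | rfl
  · obtain rfl : b = y₂ := hzb.resolve_left hab.symm
    exact ⟨_, hn.2, hq, rfl, hlast, hlen', hmem'⟩
  · obtain rfl : b = y₁ := hzb.resolve_right hab.symm
    refine ⟨(a :: (r ++ [b])).reverse, List.nodup_reverse.2 hn.2, ?_, ?_, ?_, ?_, ?_⟩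
    · exact List.isChain_reverse.2 (hq.imp fun _ _ h => h.symm)
    · rw [List.head?_reverse, hlast]
    · rw [List.getLast?_reverse, List.head?_cons]
    · rw [List.length_reverse, hlen']
    · exact fun v hv => hmem' v (List.mem_reverse.1 hv)

end Chvatal

/-! ### Double counting and the choice of cycle vertices. -/

section Counting

open Finset
open scoped Classical

variable {V : Type*}

theorem degIn_le_of_sup_eq {G R B : SimpleGraph V} (h : R ⊔ B = G) (v : V) (A : Finset V) :
    degIn G v A ≤ degIn R v A + degIn B v A := by
  refine (card_le_card fun w hw => ?_).trans (card_union_le _ _)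
  rw [mem_filter, ← h, SimpleGraph.sup_adj] at hw
  rw [mem_union, mem_filter, mem_filter]
  tauto

theorem degIn_le_degIn_add_card_sdiff (H : SimpleGraph V) (v : V) (A B : Finset V) :
    (degIn H v A : ℝ) ≤ degIn H v B + (A \ B).card := by
  have : degIn H v A ≤ degIn H v B + (A \ B).card := by
    refine (card_le_card fun w hw => ?_).trans (card_union_le _ _)
    rw [mem_filter] at hw
    rw [mem_union, mem_filter, mem_sdiff]
    tauto
  exact_mod_cast this

theorem card_sdiff_eq_add (A B : Finset V) :
    ((A \ B).card : ℝ) = A.card - B.card + (B \ A).card := by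
  have h1 := card_sdiff_add_card A B
  have h2 := card_sdiff_add_card B A
  rw [union_comm, ← h1] at h2
  have : ((B \ A).card : ℝ) + A.card = (A \ B).card + B.card := by exact_mod_cast h2
  linarith

theorem sum_degIn_comm (H : SimpleGraph V) (S T : Finset V) :
    ∑ x ∈ S, degIn H x T = ∑ y ∈ T, degIn H y S := by
  have := sum_card_bipartiteAbove_eq_sum_card_bipartiteBelow (s := S) (t := T) H.Adj
  unfold bipartiteAbove bipartiteBelow at this
  unfold degIn
  simp_rw [H.adj_comm] at this ⊢
  convert this using 4

theorem edgesBetween_eq_sum_degIn (H : SimpleGraph V) (S T : Finset V) :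
    edgesBetween H S T = ∑ x ∈ S, degIn H x T := by
  unfold edgesBetween degIn
  rw [SimpleGraph.interedges_def, card_filter, sum_product]
  exact sum_congr rfl fun x _ => (card_filter _ _).symm

/-- Markov's inequality for degrees; it turns a bound on the number of edges into a bound on the
number of exceptional vertices. -/
theorem mul_card_filter_le_sum_degIn (H : SimpleGraph V) (S T : Finset V) (t : ℝ) :
    t * (S.filter fun x => t ≤ degIn H x T).card ≤ ((∑ x ∈ S, degIn H x T : ℕ) : ℝ) := by
  rw [mul_comm, ← nsmul_eq_mul]
  refine (card_nsmul_le_sum _ (fun x => (degIn H x T : ℝ)) t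
    fun x hx => (mem_filter.1 hx).2).trans ?_
  push_cast
  exact sum_le_sum_of_subset_of_nonneg (filter_subset _ _) fun _ _ _ => Nat.cast_nonneg _

/-- A set of prescribed size in `P` that takes as much from `A` as possible. -/
theorem exists_subset_card_eq_of_prefer {A P : Finset V} (hAP : A ⊆ P) {m : ℕ} (hm : m ≤ P.card) :
    ∃ S ⊆ P, S.card = m ∧ (S \ A).card = m - A.card := by
  rcases le_total m A.card with h | h
  · obtain ⟨S, hS, hSm⟩ := exists_subset_card_eq h
    refine ⟨S, hS.trans hAP, hSm, ?_⟩
    rw [sdiff_eq_empty_iff_subset.2 hS, card_empty]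
    omega
  · obtain ⟨S, hAS, hSP, hSm⟩ := exists_subsuperset_card_eq hAP h hm
    exact ⟨S, hSP, hSm, by rw [card_sdiff_of_subset hAS, hSm]⟩

/-- A natural number below `1 / 2 + b` is at most `2 * b`. -/
theorem natSub_le_two_mul {m k : ℕ} {b : ℝ} (hb : 0 ≤ b) (h : (m : ℝ) ≤ k + 1 / 2 + b) :
    ((m - k : ℕ) : ℝ) ≤ 2 * b := by
  rcases le_or_gt m k with hmk | hmk
  · rw [Nat.sub_eq_zero_of_le hmk]
    push_cast
    linarith
  · have h1 : (k : ℝ) + 1 ≤ m := by exact_mod_cast hmk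
    rw [Nat.cast_sub hmk.le]
    linarith

/-- A Hamiltonian cycle in a bipartite graph in which all vertices outside of the small
exceptional sets `S \ A` and `T \ C` have large degree, and most of them very large degree. -/
theorem exists_cycleList_of_typical [Finite V] (H : SimpleGraph V) {S T A C E F : Finset V}
    (hST : Disjoint S T) {m : ℕ} (hSm : S.card = m) (hTm : T.card = m) (hm : 2 ≤ m) {a f h : ℝ}
    (hh : a + f ≤ h)
    (hSA : ((S \ A).card : ℝ) ≤ a) (hE : (E.card : ℝ) ≤ f)
    (hTC : ((T \ C).card : ℝ) ≤ a) (hF : (F.card : ℝ) ≤ f)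
    (hS : ∀ x ∈ S, a < degIn H x T) (hS1 : ∀ x ∈ S, x ∈ A → h < degIn H x T)
    (hS2 : ∀ x ∈ S, x ∈ A → x ∉ E → (m : ℝ) < 2 * degIn H x T)
    (hT : ∀ y ∈ T, a < degIn H y S) (hT1 : ∀ y ∈ T, y ∈ C → h < degIn H y S)
    (hT2 : ∀ y ∈ T, y ∈ C → y ∉ F → (m : ℝ) < 2 * degIn H y S) :
    ∃ l : List V, IsCycleList H l ∧ ∀ v, v ∈ l ↔ v ∈ S ∨ v ∈ T := by
  have ha : 0 ≤ a := le_trans (Nat.cast_nonneg _) hSA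
  have key1 : ∀ {S A T : Finset V} (_ : ((S \ A).card : ℝ) ≤ a)
      (_ : ∀ x ∈ S, x ∈ A → h < degIn H x T),
      ((S.filter fun x => (degIn H x T : ℝ) ≤ h).card : ℝ) ≤ a := by
    intro S A T h0 h1
    refine le_trans (Nat.cast_le.2 (card_le_card fun x hx => ?_)) h0
    rw [mem_filter] at hx
    exact mem_sdiff.2 ⟨hx.1, fun hxA => not_lt.2 hx.2 (h1 x hx.1 hxA)⟩
  have key2 : ∀ {S A E T : Finset V} (_ : ((S \ A).card : ℝ) ≤ a) (_ : (E.card : ℝ) ≤ f)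
      (_ : ∀ x ∈ S, x ∈ A → x ∉ E → (m : ℝ) < 2 * degIn H x T),
      ((S.filter fun x => 2 * degIn H x T ≤ m).card : ℝ) ≤ h := by
    intro S A E T h0 h1 h2
    have hsub : (S.filter fun x => 2 * degIn H x T ≤ m) ⊆ (S \ A) ∪ E := by
      intro x hx
      rw [mem_filter] at hx
      rw [mem_union, mem_sdiff]
      by_contra hcon
      push Not at hcon
      have := h2 x hx.1 (hcon.1 hx.1) hcon.2
      exact absurd hx.2 (not_le.2 (by exact_mod_cast this))
    have := (card_le_card hsub).trans (card_union_le _ _)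
    have h3 : ((S.filter fun x => 2 * degIn H x T ≤ m).card : ℝ) ≤ (S \ A).card + E.card := by
      exact_mod_cast this
    linarith
  exact exists_cycleList_of_levels H hST hSm hTm hm ha hS (key1 hSA hS1) (key2 hSA hE hS2) hT
    (key1 hTC hT1) (key2 hTC hF hT2)

end Counting

/-! ### The minimum degree condition in terms of the two colors. -/

section DenseColoring

open Finset
open scoped Classical

variable {V : Type*}

/-- A pair of graphs between two sets `X` and `Y` of size `n`, whose union leaves every vertex
nonadjacent to at most `n / 4 - c` vertices of the other class. -/
structure IsDenseColoring (R B : SimpleGraph V) (X Y : Finset V) (n : ℕ) (c : ℝ) : Prop where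
  disjoint : Disjoint X Y
  card_left : X.card = n
  card_right : Y.card = n
  three_le : 3 ≤ c
  four_mul_le : 4 * c ≤ n
  degIn_left : ∀ x ∈ X, ∀ A ⊆ Y, (A.card : ℝ) - (n / 4 - c) ≤ degIn R x A + degIn B x A
  degIn_right : ∀ y ∈ Y, ∀ A ⊆ X, (A.card : ℝ) - (n / 4 - c) ≤ degIn R y A + degIn B y A

/-- The symmetry that lets every lemma on blue cycles and paths serve for red ones. -/
theorem IsDenseColoring.swap {R B : SimpleGraph V} {X Y : Finset V} {n : ℕ} {c : ℝ}
    (h : IsDenseColoring R B X Y n c) : IsDenseColoring B R X Y n c where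
  disjoint := h.disjoint
  card_left := h.card_left
  card_right := h.card_right
  three_le := h.three_le
  four_mul_le := h.four_mul_le
  degIn_left x hx A hA := by rw [add_comm (degIn B x A : ℝ)]; exact h.degIn_left x hx A hA
  degIn_right y hy A hA := by rw [add_comm (degIn B y A : ℝ)]; exact h.degIn_right y hy A hA

end DenseColoring

/-! ### Monochromatic cycles and paths inside one block. -/

section Blocks

open Finset
open scoped Classical

variable {V : Type*}

/-- Markov's inequality at the threshold c/2, using gn = (c/2)(c/128). -/
theorem card_filter_half_le {H : SimpleGraph V} {S T : Finset V} {n c g k : ℝ} (hc : 0 < c)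
    (hgn : g * n = c ^ 2 / 256) (h : ((∑ x ∈ S, degIn H x T : ℕ) : ℝ) ≤ k * (g * n)) :
    ((S.filter fun x => c / 2 ≤ degIn H x T).card : ℝ) ≤ k * c / 128 := by
  have h1 := (mul_card_filter_le_sum_degIn H S T (c / 2)).trans h
  rw [hgn, show k * (c ^ 2 / 256) = c / 2 * (k * c / 128) by ring] at h1
  exact le_of_mul_le_mul_left h1 (by linarith)

theorem card_filter_eighth_le {H : SimpleGraph V} {S T : Finset V} {n g k : ℝ} (hn : 0 < n)
    (h : ((∑ x ∈ S, degIn H x T : ℕ) : ℝ) ≤ k * (g * n)) :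
    ((S.filter fun x => n / 8 ≤ degIn H x T).card : ℝ) ≤ 8 * k * g := by
  have h1 := (mul_card_filter_le_sum_degIn H S T (n / 8)).trans h
  rw [show k * (g * n) = n / 8 * (8 * k * g) by ring] at h1
  exact le_of_mul_le_mul_left h1 (by linarith)

theorem card_filter_not_eq (S : Finset V) (p : V → Prop) :
    ((S.filter fun x => ¬ p x).card : ℝ) = S.card - (S.filter p).card := by
  have := card_filter_add_card_filter_not (s := S) p
  have h : ((S.filter p).card : ℝ) + (S.filter fun x => ¬ p x).card = S.card := by
    exact_mod_cast this
  linarith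

variable {R B : SimpleGraph V} {X Y : Finset V} {n : ℕ} {c g : ℝ}

theorem length_eq_two_mul {l : List V} {H : SimpleGraph V} {S T : Finset V} {m : ℕ}
    (hl : IsCycleList H l) (hST : Disjoint S T) (hS : S.card = m) (hT : T.card = m)
    (h : ∀ v, v ∈ l ↔ v ∈ S ∨ v ∈ T) : l.length = 2 * m := by
  rw [length_eq_of_mem_iff hl.1 hST h, hS, hT]
  ring

variable [Finite V]

/-- A blue cycle in a part of the graph that contains few red edges, allowing for a few exceptional
vertices of smaller degree on both sides. -/
theorem IsDenseColoring.exists_cycleList_of_few_edges (D : IsDenseColoring R B X Y n c)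
    (hgc : 1024 * g ≤ c) (hgn : g * n = c ^ 2 / 256) {m : ℕ} (hm1 : n ≤ 2 * m)
    (hm2 : 2 * m ≤ n + 1) {X' Y₁ : Finset V} (hX' : X' ⊆ X) (hY₁ : Y₁ ⊆ Y)
    (hX'l : (n : ℝ) / 2 - g ≤ X'.card) (hX'm : X'.card ≤ m)
    (hY₁l : (n : ℝ) / 2 - g ≤ Y₁.card) (hY₁u : (Y₁.card : ℝ) ≤ n / 2 + g)
    (hsum : ((∑ x ∈ X', degIn R x Y₁ : ℕ) : ℝ) ≤ g * n)
    (hP : m ≤ (X.filter fun x => 38 * g ≤ degIn B x Y₁).card)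
    (hQ : m ≤ (Y.filter fun y => 38 * g ≤ degIn B y X').card) :
    ∃ l : List V, IsCycleList B l ∧ l.length = 2 * m := by
  have hc3 := D.three_le
  have hcn := D.four_mul_le
  have hn : (0 : ℝ) < n := by linarith
  have hg : 0 < g := by
    by_contra! hle
    have := mul_nonpos_of_nonpos_of_nonneg hle hn.le
    have : 0 < c ^ 2 := by positivity
    linarith
  have hm1' : (n : ℝ) ≤ 2 * m := by exact_mod_cast hm1
  have hm2' : (2 : ℝ) * m ≤ n + 1 := by exact_mod_cast hm2
  have hm3 : 2 ≤ m := by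
    have : (2 : ℝ) ≤ m := by linarith
    exact_mod_cast this
  have hsum' : ((∑ y ∈ Y₁, degIn R y X' : ℕ) : ℝ) ≤ 1 * (g * n) := by
    rw [one_mul, ← sum_degIn_comm]; exact hsum
  rw [← one_mul (g * n)] at hsum
  have hE := card_filter_half_le (by linarith) hgn hsum
  have hF := card_filter_half_le (by linarith) hgn hsum'
  have hA := card_filter_not_eq X' (fun x => (n : ℝ) / 8 ≤ degIn R x Y₁)
  have hC := card_filter_not_eq Y₁ (fun y => (n : ℝ) / 8 ≤ degIn R y X')
  have hA' := card_filter_eighth_le hn hsum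
  have hC' := card_filter_eighth_le hn hsum'
  set E := X'.filter fun x => c / 2 ≤ degIn R x Y₁ with hEdef
  set F := Y₁.filter fun y => c / 2 ≤ degIn R y X' with hFdef
  set A := X'.filter fun x => ¬ (n : ℝ) / 8 ≤ degIn R x Y₁ with hAdef
  set C := Y₁.filter fun y => ¬ (n : ℝ) / 8 ≤ degIn R y X' with hCdef
  have hAX' : A ⊆ X' := filter_subset _ _
  have hCY₁ : C ⊆ Y₁ := filter_subset _ _
  have hAP : A ⊆ X.filter fun x => 38 * g ≤ degIn B x Y₁ := by
    intro x hx
    rw [hAdef, mem_filter] at hx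
    refine mem_filter.2 ⟨hX' hx.1, ?_⟩
    have := D.degIn_left x (hX' hx.1) Y₁ hY₁
    linarith
  have hCQ : C ⊆ Y.filter fun y => 38 * g ≤ degIn B y X' := by
    intro y hy
    rw [hCdef, mem_filter] at hy
    refine mem_filter.2 ⟨hY₁ hy.1, ?_⟩
    have := D.degIn_right y (hY₁ hy.1) X' hX'
    linarith
  obtain ⟨S, hSP, hSm, hSA⟩ := exists_subset_card_eq_of_prefer hAP hP
  obtain ⟨T, hTQ, hTm, hTC⟩ := exists_subset_card_eq_of_prefer hCQ hQ
  have hSA' : ((S \ A).card : ℝ) ≤ 18 * g := by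
    -- Markov's inequality at n/8 removes at most 8g vertices from X', so |A| ≥ n/2 − 9g, while m ≤
    -- n/2 + 1/2. Integrality absorbs the 1/2 by doubling 9g, which matters when g is tiny.
    rw [hSA]
    exact (natSub_le_two_mul (b := 9 * g) (by linarith) (by linarith)).trans (by linarith)
  have hTC' : ((T \ C).card : ℝ) ≤ 18 * g := by
    rw [hTC]
    exact (natSub_le_two_mul (b := 9 * g) (by linarith) (by linarith)).trans (by linarith)
  have hSX : S ⊆ X := hSP.trans (filter_subset _ _)
  have hTY : T ⊆ Y := hTQ.trans (filter_subset _ _)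
  have hSX' : ((S \ X').card : ℝ) ≤ 18 * g :=
    le_trans (by exact_mod_cast card_le_card (sdiff_subset_sdiff le_rfl hAX')) hSA'
  have hTY₁ : ((T \ Y₁).card : ℝ) ≤ 18 * g :=
    le_trans (by exact_mod_cast card_le_card (sdiff_subset_sdiff le_rfl hCY₁)) hTC'
  have hX'S := card_sdiff_eq_add X' S
  have hY₁T := card_sdiff_eq_add Y₁ T
  rw [hSm] at hX'S
  rw [hTm] at hY₁T
  have hX'm' : (X'.card : ℝ) ≤ m := by exact_mod_cast hX'm
  have hdS : ∀ x ∈ S, (m : ℝ) - (n / 4 - c) - 18 * g - degIn R x Y₁ ≤ degIn B x T := by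
    intro x hx
    have h1 := D.degIn_left x (hSX hx) T hTY
    have h2 := degIn_le_degIn_add_card_sdiff R x T Y₁
    rw [hTm] at h1
    linarith
  have hdT : ∀ y ∈ T, (m : ℝ) - (n / 4 - c) - 18 * g - degIn R y X' ≤ degIn B y S := by
    intro y hy
    have h1 := D.degIn_right y (hTY hy) S hSX
    have h2 := degIn_le_degIn_add_card_sdiff R y S X'
    rw [hSm] at h1
    linarith
  have hST : Disjoint S T := D.disjoint.mono hSX hTY
  suffices h : ∃ l : List V, IsCycleList B l ∧ ∀ v, v ∈ l ↔ v ∈ S ∨ v ∈ T by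
    obtain ⟨l, hl, hmem⟩ := h
    exact ⟨l, hl, length_eq_two_mul hl hST hSm hTm hmem⟩
  -- The threshold 38g leaves room: at most 19g vertices of Y₁ lie outside T and at most 18g
  -- vertices of X' outside S, so even poor vertices keep at least 19g > 18g blue neighbours.
  refine exists_cycleList_of_typical B hST hSm hTm hm3 (a := 18 * g)
    (f := 1 * c / 128) le_rfl hSA' hE hTC' hF ?_ ?_ ?_ ?_ ?_ ?_
  · intro x hx
    have h1 := (mem_filter.1 (hSP hx)).2
    have h2 := degIn_le_degIn_add_card_sdiff B x Y₁ T
    linarith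
  · intro x hx hxA
    have h1 := hdS x hx
    have h2 := (mem_filter.1 hxA).2
    linarith
  · intro x hx hxA hxE
    have h1 := hdS x hx
    have h2 : ¬ c / 2 ≤ degIn R x Y₁ := fun h => hxE (mem_filter.2 ⟨hAX' hxA, h⟩)
    linarith
  · intro y hy
    have h1 := (mem_filter.1 (hTQ hy)).2
    have h2 := degIn_le_degIn_add_card_sdiff B y X' S
    linarith
  · intro y hy hyC
    have h1 := hdT y hy
    have h2 := (mem_filter.1 hyC).2
    linarith
  · intro y hy hyC hyF
    have h1 := hdT y hy
    have h2 : ¬ c / 2 ≤ degIn R y X' := fun h => hyF (mem_filter.2 ⟨hCY₁ hyC, h⟩)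
    linarith

/-- A blue cycle in a part of the graph in which all vertices on one side have very small red
degree, allowing for a few exceptional vertices on the other side. -/
theorem IsDenseColoring.exists_cycleList_of_small_degree (D : IsDenseColoring R B X Y n c)
    (hgc : 1024 * g ≤ c) (hgn : g * n = c ^ 2 / 256) (hg1 : 1 ≤ 18 * g) {m : ℕ}
    (hm1 : n ≤ 2 * m) (hm2 : 2 * m ≤ n + 1) {Z Y₁ : Finset V} (hZ : Z ⊆ X) (hY₁ : Y₁ ⊆ Y)
    (hZm : m ≤ Z.card) (hZu : (Z.card : ℝ) ≤ n / 2 + 9 * g)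
    (hY₁l : (n : ℝ) / 2 - g ≤ Y₁.card)
    (hdZ : ∀ x ∈ Z, (degIn R x Y₁ : ℝ) ≤ 38 * g)
    (hsum : ((∑ y ∈ Y₁, degIn R y Z : ℕ) : ℝ) ≤ 20 * (g * n))
    (hQ : m ≤ (Y.filter fun y => 180 * g ≤ degIn B y Z).card) :
    ∃ l : List V, IsCycleList B l ∧ l.length = 2 * m := by
  have hc3 := D.three_le
  have hcn := D.four_mul_le
  have hn : (0 : ℝ) < n := by linarith
  have hm1' : (n : ℝ) ≤ 2 * m := by exact_mod_cast hm1
  have hm2' : (2 : ℝ) * m ≤ n + 1 := by exact_mod_cast hm2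
  have hm3 : 2 ≤ m := by
    have : (2 : ℝ) ≤ m := by linarith
    exact_mod_cast this
  have hF := card_filter_half_le (by linarith) hgn hsum
  have hC := card_filter_not_eq Y₁ (fun y => (n : ℝ) / 8 ≤ degIn R y Z)
  have hC' := card_filter_eighth_le hn hsum
  set F := Y₁.filter fun y => c / 2 ≤ degIn R y Z with hFdef
  set C := Y₁.filter fun y => ¬ (n : ℝ) / 8 ≤ degIn R y Z with hCdef
  have hCY₁ : C ⊆ Y₁ := filter_subset _ _
  have hZm' : (m : ℝ) ≤ Z.card := by exact_mod_cast hZm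
  have hCQ : C ⊆ Y.filter fun y => 180 * g ≤ degIn B y Z := by
    intro y hy
    rw [hCdef, mem_filter] at hy
    refine mem_filter.2 ⟨hY₁ hy.1, ?_⟩
    have := D.degIn_right y (hY₁ hy.1) Z hZ
    linarith
  obtain ⟨S, hSZ, hSm⟩ := exists_subset_card_eq hZm
  obtain ⟨T, hTQ, hTm, hTC⟩ := exists_subset_card_eq_of_prefer hCQ hQ
  -- The 170 is g + 160g + 9g: the deficit of Y₁, the vertices removed at n/8, and the rounding 1/2
  -- ≤ 9g.
  have hTC' : ((T \ C).card : ℝ) ≤ 170 * g := by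
    rw [hTC]
    have : (m : ℝ) ≤ C.card + 170 * g := by linarith
    rcases le_or_gt m C.card with h | h
    · rw [Nat.sub_eq_zero_of_le h]
      push_cast
      linarith
    · rw [Nat.cast_sub h.le]
      linarith
  have hSX : S ⊆ X := hSZ.trans hZ
  have hTY : T ⊆ Y := hTQ.trans (filter_subset _ _)
  have hTY₁ : ((T \ Y₁).card : ℝ) ≤ 170 * g :=
    le_trans (by exact_mod_cast card_le_card (sdiff_subset_sdiff le_rfl hCY₁)) hTC'
  have hZS := card_sdiff_eq_add Z S
  rw [hSm, sdiff_eq_empty_iff_subset.2 hSZ, card_empty, Nat.cast_zero, add_zero] at hZS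
  have hdS : ∀ x ∈ S, (m : ℝ) - (n / 4 - c) - 208 * g ≤ degIn B x T := by
    intro x hx
    have h1 := D.degIn_left x (hSX hx) T hTY
    have h2 := degIn_le_degIn_add_card_sdiff R x T Y₁
    have h3 := hdZ x (hSZ hx)
    rw [hTm] at h1
    linarith
  have hdT : ∀ y ∈ T, (m : ℝ) - (n / 4 - c) - degIn R y Z ≤ degIn B y S := by
    intro y hy
    have h1 := D.degIn_right y (hTY hy) S hSX
    have h2 : (degIn R y S : ℝ) ≤ degIn R y Z := by exact_mod_cast degIn_mono_set R y hSZ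
    rw [hSm] at h1
    linarith
  have hST : Disjoint S T := D.disjoint.mono hSX hTY
  have hE : (((∅ : Finset V).card : ℕ) : ℝ) ≤ 20 * c / 128 := by
    rw [card_empty]; push_cast; linarith
  have hSS : ((S \ S).card : ℝ) ≤ 170 * g := by
    rw [sdiff_self, bot_eq_empty, card_empty]; push_cast; linarith
  suffices h : ∃ l : List V, IsCycleList B l ∧ ∀ v, v ∈ l ↔ v ∈ S ∨ v ∈ T by
    obtain ⟨l, hl, hmem⟩ := h
    exact ⟨l, hl, length_eq_two_mul hl hST hSm hTm hmem⟩
  refine exists_cycleList_of_typical B hST hSm hTm hm3 (a := 170 * g)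
    (f := 20 * c / 128) le_rfl hSS hE hTC' hF ?_ ?_ ?_ ?_ ?_ ?_
  · intro x hx
    have h1 := hdS x hx
    linarith
  · intro x hx _
    have h1 := hdS x hx
    linarith
  · intro x hx _ _
    have h1 := hdS x hx
    linarith
  -- At most 9g vertices of Z are left out of S, so 180g − 9g = 171g > 170g neighbours remain.
  · intro y hy
    have h1 := (mem_filter.1 (hTQ hy)).2
    have h2 := degIn_le_degIn_add_card_sdiff B y Z S
    linarith
  · intro y hy hyC
    have h1 := hdT y hy
    have h2 := (mem_filter.1 hyC).2
    linarith
  · intro y hy hyC hyF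
    have h1 := hdT y hy
    have h2 : ¬ c / 2 ≤ degIn R y Z := fun h => hyF (mem_filter.2 ⟨hCY₁ hyC, h⟩)
    linarith

/-- A blue cycle in a part of the graph in which all red degrees are small. -/
theorem IsDenseColoring.exists_cycleList_of_all_small (D : IsDenseColoring R B X Y n c)
    {k : ℕ} (hk : n ≤ 2 * k + 1) {Z U : Finset V} (hZ : Z ⊆ X) (hU : U ⊆ Y)
    (hZk : k ≤ Z.card) (hUk : k ≤ U.card) (hdZ : ∀ x ∈ Z, (degIn R x U : ℝ) ≤ c / 2)
    (hdU : ∀ y ∈ U, (degIn R y Z : ℝ) ≤ c / 2) :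
    ∃ l : List V, IsCycleList B l ∧ l.length = 2 * k := by
  have hc3 := D.three_le
  have hcn := D.four_mul_le
  have hk' : (n : ℝ) ≤ 2 * k + 1 := by exact_mod_cast hk
  obtain ⟨S, hSZ, hSk⟩ := exists_subset_card_eq hZk
  obtain ⟨T, hTU, hTk⟩ := exists_subset_card_eq hUk
  have hST : Disjoint S T := D.disjoint.mono (hSZ.trans hZ) (hTU.trans hU)
  have hk2 : 2 ≤ k := by
    have : (2 : ℝ) ≤ k := by linarith
    exact_mod_cast this
  have hdS : ∀ x ∈ S, (k : ℝ) < 2 * degIn B x T := by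
    intro x hx
    have h1 := D.degIn_left x (hZ (hSZ hx)) T (hTU.trans hU)
    have h2 : (degIn R x T : ℝ) ≤ degIn R x U := by exact_mod_cast degIn_mono_set R x hTU
    have h3 := hdZ x (hSZ hx)
    rw [hTk] at h1
    linarith
  have hdT : ∀ y ∈ T, (k : ℝ) < 2 * degIn B y S := by
    intro y hy
    have h1 := D.degIn_right y (hU (hTU hy)) S (hSZ.trans hZ)
    have h2 : (degIn R y S : ℝ) ≤ degIn R y Z := by exact_mod_cast degIn_mono_set R y hSZ
    have h3 := hdU y (hTU hy)
    rw [hSk] at h1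
    linarith
  have hk0 : (0 : ℝ) ≤ k := Nat.cast_nonneg k
  obtain ⟨l, hl, hmem⟩ := exists_cycleList_of_typical B (A := S) (C := T) (E := ∅) (F := ∅)
    hST hSk hTk hk2 (a := 0) (f := 0) (h := 0) (by simp) (by simp) (by simp) (by simp) (by simp)
    (fun x hx => by linarith [hdS x hx]) (fun x hx _ => by linarith [hdS x hx])
    (fun x hx _ _ => hdS x hx) (fun y hy => by linarith [hdT y hy])
    (fun y hy _ => by linarith [hdT y hy]) (fun y hy _ _ => hdT y hy)
  exact ⟨l, hl, length_eq_two_mul hl hST hSk hTk hmem⟩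

/-- A blue path between given vertices in a part of the graph in which all red degrees are
small. -/
theorem IsDenseColoring.exists_path_list_of_all_small (D : IsDenseColoring R B X Y n c)
    {q : ℕ} (hq : (n : ℝ) / 2 - c / 2 ≤ q) {Z U : Finset V} (hZ : Z ⊆ X) (hU : U ⊆ Y)
    (hZq : q ≤ Z.card) (hUq : q + 1 ≤ U.card) (hdZ : ∀ x ∈ Z, (degIn R x U : ℝ) ≤ c / 2)
    (hdU : ∀ y ∈ U, (degIn R y Z : ℝ) ≤ c / 2) {z : V} (hz : z ∈ X) (hzZ : z ∉ Z) {y₁ y₂ : V}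
    (hy₁ : y₁ ∈ U) (hy₂ : y₂ ∈ U) (hy : y₁ ≠ y₂) :
    ∃ p : List V, p.Nodup ∧ p.IsChain B.Adj ∧ p.head? = some y₁ ∧ p.getLast? = some y₂ ∧
      p.length = 2 * q + 1 ∧ ∀ v ∈ p, v ∈ Z ∨ v ∈ U := by
  have hc3 := D.three_le
  have hcn := D.four_mul_le
  have hq1 : 1 ≤ q := by
    have : (1 : ℝ) ≤ q := by linarith
    exact_mod_cast this
  obtain ⟨S, hSZ, hSq⟩ := exists_subset_card_eq hZq
  -- The larger class is chosen to contain both prescribed ends.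
  obtain ⟨T, hyT, hTU, hTq⟩ := exists_subsuperset_card_eq (s := {y₁, y₂}) (t := U) (n := q + 1)
    (by intro v hv; simp only [mem_insert, mem_singleton] at hv; rcases hv with rfl | rfl <;>
          assumption) (by rw [card_pair hy]; omega) hUq
  have hST : Disjoint S T := D.disjoint.mono (hSZ.trans hZ) (hTU.trans hU)
  have hdS : ∀ x ∈ S, T.card < 2 * degIn B x T := by
    intro x hx
    have h1 := D.degIn_left x (hZ (hSZ hx)) T (hTU.trans hU)
    have h2 : (degIn R x T : ℝ) ≤ degIn R x U := by exact_mod_cast degIn_mono_set R x hTU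
    have h3 := hdZ x (hSZ hx)
    rw [hTq] at h1 ⊢
    push_cast at h1
    have : ((q + 1 : ℕ) : ℝ) < (2 * degIn B x T : ℕ) := by push_cast; linarith
    exact_mod_cast this
  have hdT : ∀ y ∈ T, T.card < 2 * degIn B y S := by
    intro y hy
    have h1 := D.degIn_right y (hU (hTU hy)) S (hSZ.trans hZ)
    have h2 : (degIn R y S : ℝ) ≤ degIn R y Z := by exact_mod_cast degIn_mono_set R y hSZ
    have h3 := hdU y (hTU hy)
    rw [hSq] at h1
    rw [hTq]
    have : ((q + 1 : ℕ) : ℝ) < (2 * degIn B y S : ℕ) := by push_cast; linarith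
    exact_mod_cast this
  obtain ⟨p, h1, h2, h3, h4, h5, h6⟩ := exists_path_list B hST (by rw [hTq, hSq]) hdS hdT
    (z := z) (fun h => hzZ (hSZ h)) (fun h => disjoint_left.1 D.disjoint hz (hU (hTU h)))
    (hyT (by simp)) (hyT (by simp)) hy
  exact ⟨p, h1, h2, h3, h4, by rw [h5, hSq], fun v hv => (h6 v hv).imp (@hSZ v) (@hTU v)⟩

end Blocks

/-! ### Joining two red blocks. -/

section Connectors

open Finset
open scoped Classical

variable {V : Type*}

theorem isChain_append_of_adj {H : SimpleGraph V} {p q : List V} {a b : V} (hp : p.IsChain H.Adj)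
    (hq : q.IsChain H.Adj) (ha : p.getLast? = some a) (hb : q.head? = some b) (hab : H.Adj a b) :
    (p ++ q).IsChain H.Adj := by
  rw [List.isChain_append]
  refine ⟨hp, hq, fun x hx y hy => ?_⟩
  rw [ha] at hx
  rw [hb] at hy
  obtain rfl : a = x := by simpa using hx
  obtain rfl : b = y := by simpa using hy
  exact hab

theorem isChain_cons_of_adj {H : SimpleGraph V} {q : List V} {a b : V}
    (hq : q.IsChain H.Adj) (hb : q.head? = some b) (hab : H.Adj a b) :
    (a :: q).IsChain H.Adj :=
  isChain_append_of_adj (p := [a]) (by simp) hq rfl hb hab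

theorem exists_adj_ne {H : SimpleGraph V} {z : V} {T : Finset V} (h : 2 ≤ degIn H z T) (y : V) :
    ∃ y' ∈ T, y' ≠ y ∧ H.Adj z y' := by
  obtain ⟨y', hy', hne⟩ := exists_mem_ne (show 1 < (T.filter (H.Adj z)).card from h) y
  rw [mem_filter] at hy'
  exact ⟨y', hy'.1, hne, hy'.2⟩

variable [Finite V] {R B : SimpleGraph V} {X Y : Finset V} {n : ℕ} {c : ℝ}

/-- A long red path through two red blocks and a vertex with red neighbours in both of them. -/
theorem IsDenseColoring.exists_path_of_connector (D : IsDenseColoring R B X Y n c) {q : ℕ}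
    (hq : (n : ℝ) / 2 - c / 2 ≤ q) {W Z T₁ T₂ : Finset V} (hW : W ⊆ X) (hZ : Z ⊆ X)
    (hT₁ : T₁ ⊆ Y) (hT₂ : T₂ ⊆ Y) (hWZ : Disjoint W Z) (hT : Disjoint T₁ T₂)
    (hWq : q ≤ W.card) (hZq : q + 1 ≤ Z.card) (hT₁q : q + 1 ≤ T₁.card) (hT₂q : q + 1 ≤ T₂.card)
    (hdW : ∀ x ∈ W, (degIn B x T₁ : ℝ) ≤ c / 2) (hdT₁ : ∀ y ∈ T₁, (degIn B y W : ℝ) ≤ c / 2)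
    (hdZ : ∀ x ∈ Z, (degIn B x T₂ : ℝ) ≤ c / 2) (hdT₂ : ∀ y ∈ T₂, (degIn B y Z : ℝ) ≤ c / 2)
    {z : V} (hz : z ∈ Z) (hz₁ : 2 ≤ degIn R z T₁) (hz₂ : 2 ≤ degIn R z T₂) :
    ∃ p : List V, p.Nodup ∧ p.IsChain R.Adj ∧ p.length = 4 * q + 3 := by
  obtain ⟨y₁, hy₁, -, hzy₁⟩ := exists_adj_ne hz₁ z
  obtain ⟨y₂, hy₂, hne, -⟩ := exists_adj_ne hz₁ y₁
  obtain ⟨y₃, hy₃, -, hzy₃⟩ := exists_adj_ne hz₂ z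
  obtain ⟨y₄, hy₄, hne', -⟩ := exists_adj_ne hz₂ y₃
  have hzW : z ∉ W := fun h => disjoint_left.1 hWZ h hz
  obtain ⟨p₁, hn₁, hc₁, -, hl₁, hlen₁, hm₁⟩ := D.swap.exists_path_list_of_all_small hq hW hT₁ hWq
    hT₁q hdW hdT₁ (hZ hz) hzW hy₂ hy₁ hne
  obtain ⟨p₂, hn₂, hc₂, hh₂, -, hlen₂, hm₂⟩ := D.swap.exists_path_list_of_all_small hq
    ((erase_subset z Z).trans hZ) hT₂ (by rw [card_erase_of_mem hz]; omega) hT₂q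
    (fun x hx => hdZ x (mem_of_mem_erase hx))
    (fun y hy => le_trans (by exact_mod_cast degIn_mono_set B y (erase_subset z Z)) (hdT₂ y hy))
    (hZ hz) (notMem_erase z Z) hy₃ hy₄ hne'.symm
  have hXY : ∀ {v}, v ∈ X → v ∈ Y → False := fun h h' => disjoint_left.1 D.disjoint h h'
  have hWZ' : ∀ {v}, v ∈ W → v ∈ Z → False := fun h h' => disjoint_left.1 hWZ h h'
  have hT' : ∀ {v}, v ∈ T₁ → v ∈ T₂ → False := fun h h' => disjoint_left.1 hT h h'
  refine ⟨p₁ ++ z :: p₂, ?_, ?_, ?_⟩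
  · refine List.Nodup.append hn₁ (List.nodup_cons.2 ⟨fun h => ?_, hn₂⟩) fun v hv hv' => ?_
    · rcases hm₂ z h with h | h
      · exact notMem_erase z Z h
      · exact hXY (hZ hz) (hT₂ h)
    · rw [List.mem_cons] at hv'
      have hv₂ : v ∈ Z ∨ v ∈ T₂ := by
        rcases hv' with rfl | hv'
        · exact Or.inl hz
        · exact (hm₂ v hv').imp_left mem_of_mem_erase
      rcases hm₁ v hv with h | h <;> rcases hv₂ with h' | h'
      · exact hWZ' h h'
      · exact hXY (hW h) (hT₂ h')
      · exact hXY (hZ h') (hT₁ h)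
      · exact hT' h h'
  · exact isChain_append_of_adj hc₁ (isChain_cons_of_adj hc₂ hh₂ hzy₃) hl₁ rfl hzy₁.symm
  · rw [List.length_append, List.length_cons, hlen₁, hlen₂]
    ring

/-- A long red cycle through two red blocks and two vertices with red neighbours in both of
them. -/
theorem IsDenseColoring.exists_cycle_of_connectors (D : IsDenseColoring R B X Y n c) {q : ℕ}
    (hq : (n : ℝ) / 2 - c / 2 ≤ q) {W Z T₁ T₂ : Finset V} (hW : W ⊆ X) (hZ : Z ⊆ X)
    (hT₁ : T₁ ⊆ Y) (hT₂ : T₂ ⊆ Y) (hWZ : Disjoint W Z) (hT : Disjoint T₁ T₂)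
    (hWq : q ≤ W.card) (hZq : q + 2 ≤ Z.card) (hT₁q : q + 1 ≤ T₁.card) (hT₂q : q + 1 ≤ T₂.card)
    (hdW : ∀ x ∈ W, (degIn B x T₁ : ℝ) ≤ c / 2) (hdT₁ : ∀ y ∈ T₁, (degIn B y W : ℝ) ≤ c / 2)
    (hdZ : ∀ x ∈ Z, (degIn B x T₂ : ℝ) ≤ c / 2) (hdT₂ : ∀ y ∈ T₂, (degIn B y Z : ℝ) ≤ c / 2)
    {z z' : V} (hz : z ∈ Z) (hz' : z' ∈ Z) (hzz' : z ≠ z')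
    (hz₁ : 2 ≤ degIn R z T₁) (hz₂ : 2 ≤ degIn R z T₂)
    (hz₁' : 2 ≤ degIn R z' T₁) (hz₂' : 2 ≤ degIn R z' T₂) :
    ∃ l : List V, IsCycleList R l ∧ l.length = 4 * q + 4 := by
  obtain ⟨y₁, hy₁, -, hzy₁⟩ := exists_adj_ne hz₁ z
  obtain ⟨y₂, hy₂, hne, hzy₂⟩ := exists_adj_ne hz₁' y₁
  obtain ⟨y₃, hy₃, -, hzy₃⟩ := exists_adj_ne hz₂' z
  obtain ⟨y₄, hy₄, hne', hzy₄⟩ := exists_adj_ne hz₂ y₃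
  have hzW : z ∉ W := fun h => disjoint_left.1 hWZ h hz
  have hsub : (Z.erase z).erase z' ⊆ Z := (erase_subset _ _).trans (erase_subset _ _)
  obtain ⟨p₁, hn₁, hc₁, hh₁, hl₁, hlen₁, hm₁⟩ := D.swap.exists_path_list_of_all_small hq hW hT₁ hWq
    hT₁q hdW hdT₁ (hZ hz) hzW hy₁ hy₂ hne.symm
  obtain ⟨p₂, hn₂, hc₂, hh₂, hl₂, hlen₂, hm₂⟩ := D.swap.exists_path_list_of_all_small hq
    (hsub.trans hZ) hT₂
    (by rw [card_erase_of_mem (mem_erase.2 ⟨hzz'.symm, hz'⟩), card_erase_of_mem hz]; omega) hT₂q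
    (fun x hx => hdZ x (hsub hx))
    (fun y hy => le_trans (by exact_mod_cast degIn_mono_set B y hsub) (hdT₂ y hy))
    (hZ hz') (notMem_erase z' _) hy₃ hy₄ hne'.symm
  have hXY : ∀ {v}, v ∈ X → v ∈ Y → False := fun h h' => disjoint_left.1 D.disjoint h h'
  have hWZ' : ∀ {v}, v ∈ W → v ∈ Z → False := fun h h' => disjoint_left.1 hWZ h h'
  have hT' : ∀ {v}, v ∈ T₁ → v ∈ T₂ → False := fun h h' => disjoint_left.1 hT h h'
  have hzp₂ : z ∉ p₂ := fun h => by
    rcases hm₂ z h with h | h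
    · simp at h
    · exact hXY (hZ hz) (hT₂ h)
  have hzp₂' : z' ∉ p₂ := fun h => by
    rcases hm₂ z' h with h | h
    · simp at h
    · exact hXY (hZ hz') (hT₂ h)
  have hzp₁ : ∀ v ∈ Z, v ∉ p₁ := fun v hv h => by
    rcases hm₁ v h with h | h
    · exact hWZ' h hv
    · exact hXY (hZ hv) (hT₁ h)
  have hne₂ : p₂ ≠ [] := by rintro rfl; simp at hh₂
  refine ⟨z :: p₁ ++ z' :: p₂, ⟨?_, ?_, ?_⟩, ?_⟩
  · refine List.Nodup.append (List.nodup_cons.2 ⟨hzp₁ z hz, hn₁⟩)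
      (List.nodup_cons.2 ⟨hzp₂', hn₂⟩) fun v hv hv' => ?_
    rw [List.mem_cons] at hv hv'
    rcases hv with rfl | hv <;> rcases hv' with rfl | hv'
    · exact hzz' rfl
    · exact hzp₂ hv'
    · exact hzp₁ _ hz' hv
    · rcases hm₁ v hv with h | h <;> rcases hm₂ v hv' with h' | h'
      · exact hWZ' h (hsub h')
      · exact hXY (hW h) (hT₂ h')
      · exact hXY (hZ (hsub h')) (hT₁ h)
      · exact hT' h h'
  · have hne₁ : p₁ ≠ [] := by rintro rfl; simp at hh₁
    refine isChain_append_of_adj (isChain_cons_of_adj hc₁ hh₁ hzy₁)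
      (isChain_cons_of_adj hc₂ hh₂ hzy₃) ?_ rfl hzy₂.symm
    obtain ⟨a, p, rfl⟩ := List.exists_cons_of_ne_nil hne₁
    rw [List.getLast?_cons_cons, hl₁]
  · intro a ha b hb
    obtain ⟨d, p, rfl⟩ := List.exists_cons_of_ne_nil hne₂
    rw [List.getLast?_append_of_ne_nil _ (by simp), List.getLast?_cons_cons, hl₂] at ha
    obtain rfl : y₄ = a := by simpa using ha
    obtain rfl : z = b := by simpa using hb
    exact hzy₄.symm
  · rw [List.length_append, List.length_cons, List.length_cons, hlen₁, hlen₂]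
    ring

/-- The case in which both colors split into two blocks. -/
theorem IsDenseColoring.exists_of_four_blocks (D : IsDenseColoring R B X Y n c) {q : ℕ}
    (hq : (n : ℝ) / 2 - c / 2 ≤ q) {W Z T₁ T₂ U : Finset V} (hW : W ⊆ X) (hZ : Z ⊆ X)
    (hT₁ : T₁ ⊆ Y) (hT₂ : T₂ ⊆ Y) (hU : U ⊆ Y) (hWZ : Disjoint W Z) (hT : Disjoint T₁ T₂)
    (hWq : q ≤ W.card) (hZq : q + 2 ≤ Z.card) (hT₁q : q + 1 ≤ T₁.card) (hT₂q : q + 1 ≤ T₂.card)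
    (hZn : n / 2 + 1 ≤ Z.card) (hUn : n / 2 + 1 ≤ U.card)
    (hdW : ∀ x ∈ W, (degIn B x T₁ : ℝ) ≤ c / 2) (hdT₁ : ∀ y ∈ T₁, (degIn B y W : ℝ) ≤ c / 2)
    (hdZ : ∀ x ∈ Z, (degIn B x T₂ : ℝ) ≤ c / 2) (hdT₂ : ∀ y ∈ T₂, (degIn B y Z : ℝ) ≤ c / 2)
    (hdU : ∀ y ∈ U, (degIn R y Z : ℝ) ≤ c / 2)
    (hz₁ : ∀ z ∈ Z, c / 2 < degIn R z U → 2 ≤ degIn R z T₁) (hz₂ : ∀ z ∈ Z, 2 ≤ degIn R z T₂) :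
    (HasPathOfOrderAtLeast R (2 * ((n + 1) / 2)) ∨ HasPathOfOrderAtLeast B (2 * ((n + 1) / 2))) ∧
    (HasCycleOfLengthAtLeast R (2 * (n / 2)) ∨ HasCycleOfLengthAtLeast B (2 * (n / 2))) := by
  have hc3 := D.three_le
  have hcn := D.four_mul_le
  have hn12 : 12 ≤ n := by
    have : (12 : ℝ) ≤ n := by linarith
    exact_mod_cast this
  -- Since 4c ≤ n, two blocks with sides of about n/2 − c/2 already cover n vertices, so the red
  -- blocks can afford to lose vertices.
  have hqn : n ≤ 4 * q := by
    have : (n : ℝ) ≤ 4 * q := by linarith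
    exact_mod_cast this
  -- The connectors: the only vertices that obstruct a blue cycle in (Z, U), and by `hz₁` and `hz₂`
  -- exactly what joins the red blocks.
  set C := Z.filter fun z => c / 2 < degIn R z U with hC
  have hCZ : C ⊆ Z := filter_subset _ _
  have hblue : ∀ k, n ≤ 2 * k + 1 → k ≤ n / 2 + 1 → k + C.card ≤ Z.card →
      ∃ l : List V, IsCycleList B l ∧ l.length = 2 * k := by
    intro k hk hk' hkC
    refine D.exists_cycleList_of_all_small hk (Z := Z \ C) (sdiff_subset.trans hZ) hU
      (by rw [card_sdiff_of_subset hCZ]; omega) (by omega) (fun x hx => ?_)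
      fun y hy => le_trans (by exact_mod_cast degIn_mono_set R y sdiff_subset) (hdU y hy)
    rw [mem_sdiff, hC, mem_filter] at hx
    exact not_lt.1 fun h => hx.2 ⟨hx.1, h⟩
  rcases le_or_gt C.card 1 with hC1 | hC1
  · refine ⟨?_, Or.inr ?_⟩
    · rcases C.eq_empty_or_nonempty with h0 | ⟨z, hz⟩
      · obtain ⟨l, hl, hlen⟩ := hblue ((n + 1) / 2) (by omega) (by omega)
          (by rw [h0, card_empty]; omega)
        exact Or.inr (hasPathOfOrderAtLeast_of_isChain hl.1 hl.2.1
          (List.ne_nil_of_length_pos (by omega)) hlen.ge)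
      · rw [hC, mem_filter] at hz
        obtain ⟨p, hn, hc, hlen⟩ := D.exists_path_of_connector hq hW hZ hT₁ hT₂ hWZ hT hWq
          (by omega) hT₁q hT₂q hdW hdT₁ hdZ hdT₂ hz.1 (hz₁ z hz.1 hz.2) (hz₂ z hz.1)
        exact Or.inl (hasPathOfOrderAtLeast_of_isChain hn hc (List.ne_nil_of_length_pos (by omega)) (by omega))
    -- Z has at least ⌊n/2⌋ + 1 vertices, so it can spare one connector.
    · obtain ⟨l, hl, hlen⟩ := hblue (n / 2) (by omega) (by omega) (by omega)
      exact hl.hasCycle (by omega) hlen.ge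
  · obtain ⟨z, hz, z', hz', hne⟩ := one_lt_card.1 hC1
    rw [hC, mem_filter] at hz hz'
    obtain ⟨l, hl, hlen⟩ := D.exists_cycle_of_connectors hq hW hZ hT₁ hT₂ hWZ hT hWq
      hZq hT₁q hT₂q hdW hdT₁ hdZ hdT₂ hz.1 hz'.1 hne (hz₁ z hz.1 hz.2) (hz₂ z hz.1)
      (hz₁ z' hz'.1 hz'.2) (hz₂ z' hz'.1)
    exact ⟨Or.inl (hasPathOfOrderAtLeast_of_isChain hl.1 hl.2.1 (List.ne_nil_of_length_pos (by omega))
      (by omega)), Or.inl (hl.hasCycle (by omega) (by omega))⟩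

end Connectors

/-! ### The case analysis for extremal colorings. -/

section Extremal

open Finset
open scoped Classical

variable {V : Type*}

theorem IsCycleList.hasPath_and_hasCycle {H : SimpleGraph V} {l : List V} (hl : IsCycleList H l)
    {n : ℕ} (hn : 4 ≤ n) (hlen : l.length = 2 * ((n + 1) / 2)) :
    HasPathOfOrderAtLeast H (2 * ((n + 1) / 2)) ∧ HasCycleOfLengthAtLeast H (2 * (n / 2)) :=
  ⟨hasPathOfOrderAtLeast_of_isChain hl.1 hl.2.1 (List.ne_nil_of_length_pos (by omega)) hlen.ge,
    hl.hasCycle (by omega) (by omega)⟩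

variable {R B : SimpleGraph V} {X Y : Finset V} {n : ℕ} {c g : ℝ}

theorem card_le_degIn {H : SimpleGraph V} {v : V} {N T : Finset V}
    (h : ∀ w ∈ N, w ∈ T ∧ H.Adj v w) : N.card ≤ degIn H v T :=
  card_le_card fun w hw => mem_filter.2 (h w hw)

/-- The vertices of one class of a balanced bipartite graph of large minimum degree have few
nonneighbours in the other class. -/
theorem le_degIn_of_le_minDegree [Fintype V] {G : SimpleGraph V} [DecidableRel G.Adj] {x : V}
    {d : ℝ} (hd : d ≤ G.minDegree) (hYn : Y.card = n) (hx : ∀ w, G.Adj x w → w ∈ Y)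
    {A : Finset V} (hA : A ⊆ Y) : (A.card : ℝ) - (n - d) ≤ degIn G x A := by
  have h1 : G.minDegree ≤ degIn G x Y := by
    refine (G.minDegree_le_degree x).trans ?_
    rw [← G.card_neighborFinset_eq_degree]
    refine card_le_degIn fun w hw => ?_
    rw [SimpleGraph.mem_neighborFinset] at hw
    exact ⟨hx w hw, hw⟩
  have h1' : (G.minDegree : ℝ) ≤ degIn G x Y := by exact_mod_cast h1
  have h2 := degIn_le_degIn_add_card_sdiff G x Y A
  have h3 := card_sdiff_eq_add Y A
  rw [hYn, sdiff_eq_empty_iff_subset.2 hA, card_empty, Nat.cast_zero] at h3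
  linarith

theorem isDenseColoring_of_le_minDegree [Fintype V] {G : SimpleGraph V} [DecidableRel G.Adj]
    (hG : IsBalancedBipartite G X Y n) (hRB : IsTwoColoring G R B) (hc3 : 3 ≤ c)
    (hcn : 4 * c ≤ n) (hd : 3 / 4 * n + c ≤ G.minDegree) : IsDenseColoring R B X Y n c where
  disjoint := by exact_mod_cast hG.bipartite.disjoint
  card_left := hG.card_left
  card_right := hG.card_right
  three_le := hc3
  four_mul_le := hcn
  degIn_left x hx A hA := by
    have h1 := le_degIn_of_le_minDegree hd hG.card_right
      (fun w hw => hG.bipartite.mem_of_mem_adj hx hw) hA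
    have h2 : (degIn G x A : ℝ) ≤ degIn R x A + degIn B x A := by
      exact_mod_cast degIn_le_of_sup_eq hRB x A
    linarith
  degIn_right y hy A hA := by
    have h1 := le_degIn_of_le_minDegree hd hG.card_left
      (fun w hw => hG.bipartite.symm.mem_of_mem_adj hy hw) hA
    have h2 : (degIn G y A : ℝ) ≤ degIn R y A + degIn B y A := by
      exact_mod_cast degIn_le_of_sup_eq hRB y A
    linarith

variable [Finite V]

/-- The conclusion for an extremal coloring, if at least half of the vertices of `Y` have some
blue neighbours in `X'`. -/
theorem IsDenseColoring.exists_path_and_cycle (D : IsDenseColoring R B X Y n c)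
    (hgc : 1024 * g ≤ c) (hgn : g * n = c ^ 2 / 256) {X' Y₁ Y₂ : Finset V} (hX' : X' ⊆ X)
    (hY : ∀ v, v ∈ Y ↔ v ∈ Y₁ ∨ v ∈ Y₂) (hY₁₂ : Disjoint Y₁ Y₂)
    (hX'l : (n : ℝ) / 2 - g ≤ X'.card) (hX'm : X'.card ≤ (n + 1) / 2)
    (hY₁l : (n : ℝ) / 2 - g ≤ Y₁.card) (hY₂l : (n : ℝ) / 2 - g ≤ Y₂.card)
    (hR : ((∑ x ∈ X', degIn R x Y₁ : ℕ) : ℝ) ≤ g * n)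
    (hB : ((∑ x ∈ X', degIn B x Y₂ : ℕ) : ℝ) ≤ g * n)
    (hQ : (n + 1) / 2 ≤ (Y.filter fun y => 38 * g ≤ degIn B y X').card) :
    (HasPathOfOrderAtLeast R (2 * ((n + 1) / 2)) ∨ HasPathOfOrderAtLeast B (2 * ((n + 1) / 2))) ∧
    (HasCycleOfLengthAtLeast R (2 * (n / 2)) ∨ HasCycleOfLengthAtLeast B (2 * (n / 2))) := by
  have hc3 := D.three_le
  have hcn := D.four_mul_le
  have hn : (0 : ℝ) < n := by linarith
  have hn12 : 12 ≤ n := by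
    have : (12 : ℝ) ≤ n := by linarith
    exact_mod_cast this
  obtain ⟨m, hm⟩ : ∃ m, m = (n + 1) / 2 := ⟨_, rfl⟩
  have hm1 : n ≤ 2 * m := by omega
  have hm2 : 2 * m ≤ n + 1 := by omega
  have hm1' : (n : ℝ) ≤ 2 * m := by exact_mod_cast hm1
  have hm2' : (2 : ℝ) * m ≤ n + 1 := by exact_mod_cast hm2
  have hY₁ : Y₁ ⊆ Y := fun v hv => (hY v).2 (Or.inl hv)
  have hY₂ : Y₂ ⊆ Y := fun v hv => (hY v).2 (Or.inr hv)
  have hYcard : (Y₁.card : ℝ) + Y₂.card = n := by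
    have : Y = Y₁ ∪ Y₂ := by ext v; rw [hY, mem_union]
    rw [← D.card_right, this, card_union_of_disjoint hY₁₂]
    push_cast
    rfl
  have hred : (∃ l, IsCycleList R l ∧ l.length = 2 * m) →
      (HasPathOfOrderAtLeast R (2 * ((n + 1) / 2)) ∨
        HasPathOfOrderAtLeast B (2 * ((n + 1) / 2))) ∧
      (HasCycleOfLengthAtLeast R (2 * (n / 2)) ∨ HasCycleOfLengthAtLeast B (2 * (n / 2))) :=
    fun ⟨l, hl, hlen⟩ =>
      (hl.hasPath_and_hasCycle (by omega) (by rw [hlen, hm])).imp Or.inl Or.inl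
  have hblue : (∃ l, IsCycleList B l ∧ l.length = 2 * m) →
      (HasPathOfOrderAtLeast R (2 * ((n + 1) / 2)) ∨
        HasPathOfOrderAtLeast B (2 * ((n + 1) / 2))) ∧
      (HasCycleOfLengthAtLeast R (2 * (n / 2)) ∨ HasCycleOfLengthAtLeast B (2 * (n / 2))) :=
    fun ⟨l, hl, hlen⟩ =>
      (hl.hasPath_and_hasCycle (by omega) (by rw [hlen, hm])).imp Or.inr Or.inr
  rw [← hm] at hX'm hQ
  by_cases hPm : m ≤ (X.filter fun x => 38 * g ≤ degIn B x Y₁).card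
  · exact hblue (D.exists_cycleList_of_few_edges hgc hgn hm1 hm2 hX' hY₁ hX'l hX'm hY₁l
      (by linarith) hR hPm hQ)
  set P := X.filter fun x => 38 * g ≤ degIn B x Y₁ with hP
  have hPX : P ⊆ X := filter_subset _ _
  have hA := card_filter_not_eq X' (fun x => (n : ℝ) / 8 ≤ degIn R x Y₁)
  rw [← one_mul (g * n)] at hR hB
  have hA' := card_filter_eighth_le hn hR
  set A := X'.filter fun x => ¬ (n : ℝ) / 8 ≤ degIn R x Y₁ with hAdef
  have hAX' : A ⊆ X' := filter_subset _ _
  have hAP : A ⊆ P := by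
    intro x hx
    rw [hAdef, mem_filter] at hx
    refine mem_filter.2 ⟨hX' hx.1, ?_⟩
    have := D.degIn_left x (hX' hx.1) Y₁ hY₁
    linarith
  have hAP' : (A.card : ℝ) ≤ P.card := by exact_mod_cast card_le_card hAP
  have hPm' : (P.card : ℝ) + 1 ≤ m := by exact_mod_cast not_le.1 hPm
  -- From n/2 − 9g ≤ |P| ≤ m − 1 ≤ n/2 − 1/2. With 1024g ≤ c this forces c > 56, which pays for all
  -- additive constants below.
  have hg1 : 1 ≤ 18 * g := by linarith
  have hZcard : (X \ P).card + P.card = n := by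
    rw [← D.card_left]; exact card_sdiff_add_card_eq_card hPX
  have hZcard' : ((X \ P).card : ℝ) + P.card = n := by exact_mod_cast hZcard
  have hZX : X \ P ⊆ X := sdiff_subset
  have hdZ : ∀ x ∈ X \ P, (degIn B x Y₁ : ℝ) ≤ 38 * g := by
    intro x hx
    rw [mem_sdiff, hP, mem_filter] at hx
    exact (not_le.1 fun h => hx.2 ⟨hx.1, h⟩).le
  have hPZ : Disjoint P (X \ P) := disjoint_sdiff
  generalize X \ P = Z at hZcard hZcard' hZX hdZ hPZ
  -- Every vertex of Z has at most 38g blue neighbours in Y₁, and |Z| ≤ n/2 + 9g ≤ 20n/38.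
  have hsum : ((∑ y ∈ Y₁, degIn B y Z : ℕ) : ℝ) ≤ 20 * (g * n) := by
    rw [← sum_degIn_comm]
    push_cast
    calc ∑ x ∈ Z, (degIn B x Y₁ : ℝ) ≤ Z.card • (38 * g) := sum_le_card_nsmul _ _ _ hdZ
      _ = Z.card * (38 * g) := nsmul_eq_mul _ _
      _ ≤ (20 / 38 * n) * (38 * g) := by
          refine mul_le_mul_of_nonneg_right ?_ (by linarith)
          linarith
      _ = 20 * (g * n) := by ring
  by_cases hYZ : m ≤ (Y.filter fun y => 180 * g ≤ degIn R y Z).card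
  · exact hred (D.swap.exists_cycleList_of_small_degree hgc hgn hg1 hm1 hm2 hZX hY₁
      (by omega) (by linarith) hY₁l hdZ hsum hYZ)
  set Q := Y.filter fun y => 180 * g ≤ degIn R y Z with hQdef
  have hUcard : (Y \ Q).card + Q.card = n := by
    rw [← D.card_right]; exact card_sdiff_add_card_eq_card (filter_subset _ _)
  have hUY : Y \ Q ⊆ Y := sdiff_subset
  have hdU : ∀ y ∈ Y \ Q, (degIn R y Z : ℝ) < 180 * g := by
    intro x hx
    rw [mem_sdiff, hQdef, mem_filter] at hx
    exact not_le.1 fun h => hx.2 ⟨hx.1, h⟩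
  generalize Y \ Q = U at hUcard hUY hdU
  have hB' : ((∑ y ∈ Y₂, degIn B y X' : ℕ) : ℝ) ≤ 1 * (g * n) := by
    rwa [← sum_degIn_comm]
  have hWc := card_filter_not_eq A (fun x => c / 2 ≤ degIn B x Y₂)
  have hT₁c := card_filter_not_eq Y₂ (fun y => c / 2 ≤ degIn B y X')
  have hT₂c := card_filter_not_eq Y₁ (fun y => c / 2 ≤ degIn B y Z)
  have hW' : ((A.filter fun x => c / 2 ≤ degIn B x Y₂).card : ℝ) ≤ 1 * c / 128 :=
    le_trans (by exact_mod_cast card_le_card (filter_subset_filter _ hAX'))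
      (card_filter_half_le (by linarith) hgn hB)
  have hT₁' := card_filter_half_le (by linarith) hgn hB'
  have hT₂' := card_filter_half_le (by linarith) hgn hsum
  have hC' := card_filter_eighth_le hn hsum
  have hq1 := Nat.le_ceil ((n : ℝ) / 2 - c / 2)
  have hq2 := Nat.ceil_lt_add_one (show 0 ≤ (n : ℝ) / 2 - c / 2 by linarith)
  generalize ⌈(n : ℝ) / 2 - c / 2⌉₊ = q at hq1 hq2
  have hqle : ∀ k : ℕ, (n : ℝ) / 2 - c / 2 + 3 ≤ k → q + 2 ≤ k := by
    intro k hk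
    have : (q : ℝ) + 2 ≤ k := by linarith
    exact_mod_cast this
  set W := A.filter fun x => ¬ c / 2 ≤ degIn B x Y₂ with hW
  set T₁ := Y₂.filter fun y => ¬ c / 2 ≤ degIn B y X' with hT₁
  set T₂ := Y₁.filter fun y => ¬ c / 2 ≤ degIn B y Z with hT₂
  have hWA : W ⊆ A := filter_subset _ _
  have hT₁Y : T₁ ⊆ Y₂ := filter_subset _ _
  have hT₂Y : T₂ ⊆ Y₁ := filter_subset _ _
  have hmono : ∀ (v : V) {S T : Finset V}, S ⊆ T → (degIn B v S : ℝ) ≤ degIn B v T :=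
    fun v S T h => by exact_mod_cast degIn_mono_set B v h
  -- A vertex of U in Y₁ has few red, hence at least n/8 blue, neighbours in Z, which is rare since
  -- (Z, Y₁) is almost red. So U is almost contained in T₁, and a vertex with more than c/2 red
  -- neighbours in U keeps two of them in T₁.
  have hUT : ((U \ T₁).card : ℝ) ≤ 8 * 20 * g + 1 * c / 128 := by
    have hsub : U \ T₁ ⊆ (Y₁.filter fun y => (n : ℝ) / 8 ≤ degIn B y Z) ∪
        (Y₂.filter fun y => c / 2 ≤ degIn B y X') := by
      intro y hy
      rw [mem_sdiff, hT₁, mem_filter] at hy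
      rw [mem_union, mem_filter, mem_filter]
      rcases (hY y).1 (hUY hy.1) with h | h
      · refine Or.inl ⟨h, ?_⟩
        have h1 := D.degIn_right y (hUY hy.1) Z hZX
        have h2 := hdU y hy.1
        linarith
      · exact Or.inr ⟨h, by_contra fun h' => hy.2 ⟨h, h'⟩⟩
    have := (card_le_card hsub).trans (card_union_le _ _)
    have h1 : ((U \ T₁).card : ℝ) ≤ (Y₁.filter fun y => (n : ℝ) / 8 ≤ degIn B y Z).card +
        (Y₂.filter fun y => c / 2 ≤ degIn B y X').card := by exact_mod_cast this
    linarith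
  refine D.exists_of_four_blocks hq1 (W := W) (Z := Z) (T₁ := T₁) (T₂ := T₂) (U := U)
    (hWA.trans (hAX'.trans hX')) hZX (hT₁Y.trans hY₂) (hT₂Y.trans hY₁) hUY
    (hPZ.mono_left (hWA.trans hAP)) (hY₁₂.symm.mono hT₁Y hT₂Y) ?_ ?_ ?_ ?_ (by omega) (by omega)
    ?_ ?_ ?_ ?_ ?_ ?_ ?_
  · have := hqle W.card (by linarith)
    omega
  · exact hqle Z.card (by linarith)
  · have := hqle T₁.card (by linarith)
    omega
  · have := hqle T₂.card (by linarith)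
    omega
  · exact fun x hx => (hmono x hT₁Y).trans (not_le.1 (mem_filter.1 hx).2).le
  · exact fun y hy => (hmono y (hWA.trans hAX')).trans (not_le.1 (mem_filter.1 hy).2).le
  · intro x hx
    have h1 := hmono x hT₂Y
    have h2 := hdZ x hx
    linarith
  · exact fun y hy => (not_le.1 (mem_filter.1 hy).2).le
  · intro y hy
    have := hdU y hy
    linarith
  · intro z _ hz
    have h1 := degIn_le_degIn_add_card_sdiff R z U T₁
    have : (2 : ℝ) ≤ degIn R z T₁ := by linarith
    exact_mod_cast this
  · intro z hz
    have h1 := D.degIn_left z (hZX hz) T₂ (hT₂Y.trans hY₁)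
    have h2 := hmono z hT₂Y
    have h3 := hdZ z hz
    have : (2 : ℝ) ≤ degIn R z T₂ := by linarith
    exact_mod_cast this

/-- Every vertex of Y has at least 38g neighbours in X' in one of the colors, so one color serves at
least half of Y; exchanging the colors together with Y₁ and Y₂ makes it blue. -/
theorem IsDenseColoring.exists_path_and_cycle_of_isExtremalColoring {η : ℝ}
    (D : IsDenseColoring R B X Y n c)
    (hgc : 1024 * g ≤ c) (hgn : g * n = c ^ 2 / 256) (hη : η * n ≤ g)
    (hext : IsExtremalColoring R B X Y n η) :
    (HasPathOfOrderAtLeast R (2 * ((n + 1) / 2)) ∨ HasPathOfOrderAtLeast B (2 * ((n + 1) / 2))) ∧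
    (HasCycleOfLengthAtLeast R (2 * (n / 2)) ∨ HasCycleOfLengthAtLeast B (2 * (n / 2))) := by
  obtain ⟨X₀, Y₁, Y₂, hX₀, hY₁₂, hY, hX₀l, hY₁l, hY₂l, hR, hB⟩ := hext
  have hc3 := D.three_le
  have hcn := D.four_mul_le
  -- The given set may be much larger than n/2; trimming it to at most ⌈n/2⌉ vertices keeps both
  -- edge bounds and ensures that a cycle can cover nearly all of it.
  obtain ⟨X', hX'X₀, hX'⟩ := exists_subset_card_eq (min_le_left X₀.card ((n + 1) / 2))
  have hX'l : (n : ℝ) / 2 - g ≤ X'.card := by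
    rcases le_total X₀.card ((n + 1) / 2) with h | h
    · rw [hX', min_eq_left h]
      linarith
    · rw [hX', min_eq_right h]
      have h1 : n ≤ 2 * ((n + 1) / 2) := by omega
      have h2 : (n : ℝ) ≤ 2 * ((n + 1) / 2 : ℕ) := by exact_mod_cast h1
      have : 0 ≤ g := by
        by_contra! hg
        have := mul_nonpos_of_nonpos_of_nonneg hg.le (Nat.cast_nonneg (α := ℝ) n)
        have : 0 < c ^ 2 := by positivity
        linarith
      linarith
  have hηg : η * (n : ℝ) ^ 2 ≤ g * n := by
    rw [pow_two, ← mul_assoc]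
    exact mul_le_mul_of_nonneg_right hη (Nat.cast_nonneg n)
  have hsum : ∀ (H : SimpleGraph V) (T : Finset V), (edgesBetween H X₀ T : ℝ) ≤ η * n ^ 2 →
      ((∑ x ∈ X', degIn H x T : ℕ) : ℝ) ≤ g * n := by
    intro H T hHT
    rw [edgesBetween_eq_sum_degIn] at hHT
    refine le_trans ?_ (hHT.trans hηg)
    exact_mod_cast sum_le_sum_of_subset hX'X₀
  have hX'X := hX'X₀.trans hX₀
  have hX'm : X'.card ≤ (n + 1) / 2 := hX'.trans_le (min_le_right _ _)
  have hcover : Y ⊆ (Y.filter fun y => 38 * g ≤ degIn B y X') ∪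
      (Y.filter fun y => 38 * g ≤ degIn R y X') := by
    intro y hy
    rw [mem_union, mem_filter, mem_filter]
    by_contra! hcon
    have h1 := hcon.1 hy
    have h2 := hcon.2 hy
    have h3 := D.degIn_right y hy X' hX'X
    linarith
  have hcard := (card_le_card hcover).trans (card_union_le _ _)
  rw [D.card_right] at hcard
  rcases le_or_gt ((n + 1) / 2) (Y.filter fun y => 38 * g ≤ degIn B y X').card with h | h
  · exact D.exists_path_and_cycle hgc hgn hX'X hY hY₁₂ hX'l hX'm (by linarith) (by linarith)
      (hsum R Y₁ hR) (hsum B Y₂ hB) h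
  · exact (D.swap.exists_path_and_cycle hgc hgn hX'X (fun v => (hY v).trans or_comm) hY₁₂.symm
      hX'l hX'm (by linarith) (by linarith) (hsum B Y₂ hB) (hsum R Y₁ hR) (by omega)).imp
      Or.symm Or.symm

end Extremal

/-! ### The choice of parameters. -/

theorem mainTheorem4 (η γ : ℝ) (hη : 0 ≤ η) (hηγ : 16 * Real.sqrt η < γ) (hγ : γ ≤ 1 / 4)
    (n : ℕ) (hn : 3 / γ ≤ (n : ℝ))
    {V : Type*} [Fintype V] (G : SimpleGraph V) [DecidableRel G.Adj] (X Y : Finset V)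
    (hG : IsBalancedBipartite G X Y n)
    (hδ : (3 / 4 + γ) * (n : ℝ) ≤ (G.minDegree : ℝ))
    (R B : SimpleGraph V) (hRB : IsTwoColoring G R B)
    (hext : IsExtremalColoring R B X Y n η) :
    (HasPathOfOrderAtLeast R (2 * ⌈(n : ℝ) / 2⌉₊) ∨
      HasPathOfOrderAtLeast B (2 * ⌈(n : ℝ) / 2⌉₊)) ∧
    (HasCycleOfLengthAtLeast R (2 * ⌊(n : ℝ) / 2⌋₊) ∨
      HasCycleOfLengthAtLeast B (2 * ⌊(n : ℝ) / 2⌋₊)) := by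
  have hsqrt := Real.sqrt_nonneg η
  have hγ0 : 0 < γ := by linarith
  have hn0 : (0 : ℝ) ≤ n := Nat.cast_nonneg n
  have hceil : ⌈(n : ℝ) / 2⌉₊ = (n + 1) / 2 := by
    have h1 : n ≤ 2 * ((n + 1) / 2) := by omega
    have h2 : 2 * ((n + 1) / 2) ≤ n + 1 := by omega
    have h1' : (n : ℝ) ≤ 2 * ((n + 1) / 2 : ℕ) := by exact_mod_cast h1
    have h2' : (2 : ℝ) * ((n + 1) / 2 : ℕ) ≤ n + 1 := by exact_mod_cast h2
    refine le_antisymm (Nat.ceil_le.2 (by linarith)) ?_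
    rw [Nat.le_iff_lt_add_one, ← Nat.cast_lt (α := ℝ)]
    push_cast
    have := Nat.le_ceil ((n : ℝ) / 2)
    linarith
  have hfloor : ⌊(n : ℝ) / 2⌋₊ = n / 2 := by
    rw [Nat.floor_div_ofNat, Nat.floor_natCast]
  have hηle : η ≤ γ ^ 2 / 256 := by
    rw [← Real.sq_sqrt hη]
    nlinarith
  have hD : IsDenseColoring R B X Y n (γ * n) :=
    isDenseColoring_of_le_minDegree hG hRB (by rwa [div_le_iff₀' hγ0] at hn) (by nlinarith)
      (by linarith)
  rw [hceil, hfloor]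
  -- The 256 is 16², from 16√η < γ; and γ ≤ 1/4 gives 1024g = 4γ²n ≤ γn = c.
  refine hD.exists_path_and_cycle_of_isExtremalColoring (g := γ ^ 2 * n / 256) ?_ (by ring) ?_ hext
  · nlinarith [mul_nonneg hγ0.le hn0]
  · nlinarith
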